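/- Let $R_1,R_2>0$ and let $S^2\times S^2\subset\mathbb R^3\times\mathbb R^3$, with coordinates $(x_1,y_1,z_1,x_2,y_2,z_2)$, carry the symplectic form $\omega=R_1\omega_{S^2}\oplus R_2\omega_{S^2}$, where $\omega_{S^2}$ is the standard area form. Consider the rational Gaudin model $$J=R_1z_1+R_2z_2,\qquad H_{t_4}=t_1z_1+t_2z_2+t_3(x_1x_2+y_1y_2)+t_4z_1z_2,$$ let $m_0=(0,0,1,0,0,-1)$ and $$t_{4,m_0}^{+}=\frac{t_1R_2-t_2R_1+2t_3\sqrt{R_1R_2}}{R_1+R_2}.$$ For canonical coordinates $(q_1,q_2,p_1,p_2)$ put $S=q_1p_2-q_2p_1$, $M=\tfrac12(q_1^2+q_2^2)$, $N=\tfrac12(p_1^2+p_2^2)$. We say that a family $H_t$ goes through a degenerate Hamiltonian Hopf bifurcation at a point $m$ and $t=\tau$ if there are $\rho\neq0$, $\sigma=\pm1$ and canonical coordinates around $m$ (i.e. $\omega=dq_1\wedge dp_1+dq_2\wedge dp_2$, with $m$ at the origin), depending smoothly on $t$ near $\tau$, such that 1. for all $t$ near $\tau$, $m$ is a singularity of rank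 $0$ of $(J,H_t)$, and the second order part of $H_t$ at $m$ is $(\rho+\nu_1(t))S+\sigma N-\nu_2(t)M$ with smooth functions $\nu_1,\nu_2$ satisfying $\nu_1(\tau)=\nu_2(\tau)=0$ and $\nu_2'(\tau)\ne0$; 2. at $t=\tau$, $H_\tau$ is in normal form up to sixth order, that is, up to an additive constant and terms of order at least $7$, $$H_\tau=\rho S+\sigma N+a_3M^2+a_4MS+a_5S^2+a_6M^3+a_7M^2S+a_8MS^2+a_9S^3;$$ 3. $a_3=0$ and $a_6\neq0$. **Corollary.** Suppose that $$t_3=\frac{2\sqrt{R_1R_2}\,(R_2t_1-R_1t_2)}{(R_1-R_2)^2},\quad R_1\ne R_2,\quad R_1t_2\ne R_2t_1,\quad R_1(t_1+2t_2)\ne R_2(2t_1+t_2),\quad t_1\neq t_2 .$$ Then $H_{t_4}$ goes through a degenerate Hamiltonian Hopf bifurcation at $m_0$ and $t_4=t_{4,m_0}^{+}$. -/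

import Mathlib

open Set Asymptotics
open scoped Topology ContDiff Matrix

/-- The ambient space `ℝ³ × ℝ³` of `S² × S²`; a point is `((x₁, y₁, z₁), (x₂, y₂, z₂))`. -/
abbrev GaudinAmbient : Type := (Fin 3 → ℝ) × (Fin 3 → ℝ)

/-- The phase space `S² × S²`, as a subset of `ℝ³ × ℝ³`. -/
def gaudinPhaseSpace : Set GaudinAmbient :=
  {v | v.1 0 ^ 2 + v.1 1 ^ 2 + v.1 2 ^ 2 = 1 ∧ v.2 0 ^ 2 + v.2 1 ^ 2 + v.2 2 ^ 2 = 1}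

/-- The symplectic form `R₁ ω_{S²} ⊕ R₂ ω_{S²}` at the point `v`, evaluated on the tangent vectors
`a` and `b`. Here `ω_{S²}` is the area form `(a, b) ↦ ⟨v, a × b⟩`, which is `dx ∧ dy / z` in the
coordinates `(x, y)` on a hemisphere. -/
def gaudinForm (R₁ R₂ : ℝ) (v a b : GaudinAmbient) : ℝ :=
  R₁ * (v.1 ⬝ᵥ (a.1 ⨯₃ b.1)) + R₂ * (v.2 ⬝ᵥ (a.2 ⨯₃ b.2))

/-- The first integral `J = R₁ z₁ + R₂ z₂`. -/
def gaudinJ (R₁ R₂ : ℝ) (v : GaudinAmbient) : ℝ := R₁ * v.1 2 + R₂ * v.2 2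

/-- The generalised Gaudin Hamiltonian
`t₀ (z₁ + z₂)² + w (t₁ z₁ + t₂ z₂) + t₃ (x₁ x₂ + y₁ y₂) + t₄ z₁ z₂`. -/
def gaudinH (w t₀ t₁ t₂ t₃ t₄ : ℝ) (v : GaudinAmbient) : ℝ :=
  t₀ * (v.1 2 + v.2 2) ^ 2 + w * (t₁ * v.1 2 + t₂ * v.2 2)
    + t₃ * (v.1 0 * v.2 0 + v.1 1 * v.2 1) + t₄ * (v.1 2 * v.2 2)

/-- The Hamiltonian of the rational Gaudin model: `t₀ = 0` and `w = 1`. -/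
def rationalGaudinH (t₁ t₂ t₃ t₄ : ℝ) : GaudinAmbient → ℝ := gaudinH 1 0 t₁ t₂ t₃ t₄

/-- The point `m₀ = (0, 0, 1, 0, 0, -1)`. -/
def gaudinM0 : GaudinAmbient := (![0, 0, 1], ![0, 0, -1])

/-- The bifurcation value `t_{4,m₀}⁺`. -/
noncomputable def t4m0Plus (R₁ R₂ w t₁ t₂ t₃ : ℝ) : ℝ :=
  (w * (t₁ * R₂ - t₂ * R₁) + 2 * t₃ * √(R₁ * R₂)) / (R₁ + R₂)

/-- `ℝ⁴` with the canonical coordinates `(q₁, q₂, p₁, p₂) = (u 0, u 1, u 2, u 3)`. -/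
abbrev CanonicalSpace : Type := Fin 4 → ℝ

/-- The standard symplectic form `dq₁ ∧ dp₁ + dq₂ ∧ dp₂`. -/
def standardForm (a b : CanonicalSpace) : ℝ :=
  (a 0 * b 2 - a 2 * b 0) + (a 1 * b 3 - a 3 * b 1)

/-- The Hilbert generator `S = q₁ p₂ - q₂ p₁`. -/
def hilbertS (u : CanonicalSpace) : ℝ := u 0 * u 3 - u 1 * u 2

/-- The Hilbert generator `M = (q₁² + q₂²) / 2`. -/
noncomputable def hilbertM (u : CanonicalSpace) : ℝ := (u 0 ^ 2 + u 1 ^ 2) / 2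

/-- The Hilbert generator `N = (p₁² + p₂²) / 2`. -/
noncomputable def hilbertN (u : CanonicalSpace) : ℝ := (u 2 ^ 2 + u 3 ^ 2) / 2

/-- `ψ` gives canonical coordinates on `S² × S²` around `z₀`, with coordinate domain `U`: it is a
smooth injective map from the neighbourhood `U` of `0` in `ℝ⁴` to `S² × S²`, it sends `0` to `z₀`,
and it pulls `R₁ ω_{S²} ⊕ R₂ ω_{S²}` back to the standard symplectic form. (The last condition makes
it an immersion between manifolds of dimension four, hence a diffeomorphism onto an open subset.) -/
structure IsCanonicalCoordinates (R₁ R₂ : ℝ) (z₀ : GaudinAmbient) (U : Set CanonicalSpace)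
    (ψ : CanonicalSpace → GaudinAmbient) : Prop where
  isOpen : IsOpen U
  zero_mem : (0 : CanonicalSpace) ∈ U
  map_zero : ψ 0 = z₀
  contDiffOn : ContDiffOn ℝ ∞ ψ U
  injOn : InjOn ψ U
  mapsTo : MapsTo ψ U gaudinPhaseSpace
  symplectic : ∀ u ∈ U, ∀ a b : CanonicalSpace,
    gaudinForm R₁ R₂ (ψ u) (fderiv ℝ ψ u a) (fderiv ℝ ψ u b) = standardForm a b

/-- A one-parameter family `t ↦ H t` of Hamiltonians on `S² × S²`, with first integral `J`, goes
through a linear Hamiltonian Hopf bifurcation at `z₀` and `t = τ`, with data `ρ ≠ 0`, `σ = ±1`,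
as exhibited by the canonical coordinates `Ψ t : U → S² × S²`, which depend smoothly on the
parameter `t ∈ (τ - ε, τ + ε)`.

For all these `t`, the point `z₀` is a singularity of rank zero of `(J, H t)`, and the terms of
second order of `H t` are `(ρ + ν₁(t)) S + σ N - ν₂(t) M`, where `ν₁(τ) = ν₂(τ) = 0` and
`ν₂'(τ) ≠ 0` (the transversality condition). -/
structure IsLinearHopfUnfolding (R₁ R₂ : ℝ) (J : GaudinAmbient → ℝ) (H : ℝ → GaudinAmbient → ℝ)
    (z₀ : GaudinAmbient) (τ ρ σ ε : ℝ) (ν₁ ν₂ : ℝ → ℝ) (U : Set CanonicalSpace)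
    (Ψ : ℝ → CanonicalSpace → GaudinAmbient) : Prop where
  rho_ne_zero : ρ ≠ 0
  sigma_eq : σ = 1 ∨ σ = -1
  eps_pos : 0 < ε
  nu₁_smooth : ContDiffOn ℝ ∞ ν₁ (Ioo (τ - ε) (τ + ε))
  nu₂_smooth : ContDiffOn ℝ ∞ ν₂ (Ioo (τ - ε) (τ + ε))
  nu₁_zero : ν₁ τ = 0
  nu₂_zero : ν₂ τ = 0
  transversal : deriv ν₂ τ ≠ 0
  coordinates_smooth : ContDiffOn ℝ ∞ (fun x : ℝ × CanonicalSpace => Ψ x.1 x.2)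
    (Ioo (τ - ε) (τ + ε) ×ˢ U)
  coordinates : ∀ t ∈ Ioo (τ - ε) (τ + ε), IsCanonicalCoordinates R₁ R₂ z₀ U (Ψ t)
  rank_zero : ∀ t ∈ Ioo (τ - ε) (τ + ε), fderiv ℝ (fun u => (J (Ψ t u), H t (Ψ t u))) 0 = 0
  second_order : ∀ t ∈ Ioo (τ - ε) (τ + ε),
    (fun u => H t (Ψ t u) - H t z₀
      - ((ρ + ν₁ t) * hilbertS u + σ * hilbertN u - ν₂ t * hilbertM u))
        =O[𝓝 0] (fun u => ‖u‖ ^ 3)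

/-- In the canonical coordinates `ψ` around `z₀`, the function `h` is in Hamiltonian Hopf normal
form up to order six (third order in the Hilbert generators): up to an additive constant,
`h = ρ S + σ N + a₃ M² + a₄ M S + a₅ S² + a₆ M³ + a₇ M² S + a₈ M S² + a₉ S³ + O(7)`. -/
def IsHopfNormalForm (h : GaudinAmbient → ℝ) (z₀ : GaudinAmbient)
    (ψ : CanonicalSpace → GaudinAmbient) (ρ σ a₃ a₄ a₅ a₆ a₇ a₈ a₉ : ℝ) : Prop :=
  (fun u => h (ψ u) - h z₀
    - (ρ * hilbertS u + σ * hilbertN u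
      + a₃ * hilbertM u ^ 2 + a₄ * (hilbertM u * hilbertS u) + a₅ * hilbertS u ^ 2
      + a₆ * hilbertM u ^ 3 + a₇ * (hilbertM u ^ 2 * hilbertS u)
      + a₈ * (hilbertM u * hilbertS u ^ 2) + a₉ * hilbertS u ^ 3))
    =O[𝓝 0] (fun u => ‖u‖ ^ 7)

/-- The family `t ↦ H t` of Hamiltonians on `S² × S²`, with first integral `J`, goes through a
degenerate Hamiltonian Hopf bifurcation at `z₀` and `t = τ`: there is a Hamiltonian Hopf bifurcation
at `z₀` and `t = τ`, and in the normal form of `H τ` the coefficient `a₃` of `M²` is zero while the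
coefficient `a₆` of `M³` is not. -/
def DegenerateHamiltonianHopf (R₁ R₂ : ℝ) (J : GaudinAmbient → ℝ) (H : ℝ → GaudinAmbient → ℝ)
    (z₀ : GaudinAmbient) (τ : ℝ) : Prop :=
  ∃ (ρ σ ε : ℝ) (ν₁ ν₂ : ℝ → ℝ) (U : Set CanonicalSpace)
    (Ψ : ℝ → CanonicalSpace → GaudinAmbient) (a₃ a₄ a₅ a₆ a₇ a₈ a₉ : ℝ),
    IsLinearHopfUnfolding R₁ R₂ J H z₀ τ ρ σ ε ν₁ ν₂ U Ψ ∧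
    IsHopfNormalForm (H τ) z₀ (Ψ τ) ρ σ a₃ a₄ a₅ a₆ a₇ a₈ a₉ ∧
    a₃ = 0 ∧ a₆ ≠ 0

/-! Around `m₀` there are canonical coordinates, built from the cylindrical area-preserving chart of
each sphere, in which `J` is `S` plus a constant and `H` is a function of `S`, `M`, `N` alone. Its
quadratic part is `ρ S + (α + β) N + (α - β) M` with `β = t₃ / √(R₁ R₂)` and `α` affine in `t₄`. The
bifurcation value is the one with `α = β`: there the coefficient of `M` passes through zero with
nonzero speed and the nilpotent form `2 β N` is left. The scaling `q ↦ c q`, `p ↦ p / c` with `c² =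
|α + β|` turns the coefficient of `N` into `σ = sign β` for all nearby parameters.

Put `a = 1 / R₁ + 1 / R₂` and `b = 1 / R₂ - 1 / R₁`. At `α = β` the coefficient of `M²` is `β a / 8
- t₄ / (4 R₁ R₂)`, and the condition on `t₃` says that it vanishes. The coefficient of `M³` is `β b²
/ 128`, nonzero since `R₁ ≠ R₂` (`rationalGaudinH_sixth_order`).

It remains to remove the other terms outside the normal form, which can be done with the image of
the bracket with `N`. This bracket sends `M` to `Q`, `Q` to `2 N` and `N`, `S` to `0`, so `M³` is
not in its image; and as there is no `M²` term, removing the quartic terms creates no `M³`. The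
symplectic maps used are time-one flows of `f(L, S)` with `L = M + s Q + s² N = |q + s p|² / 2`. For
`s = 0` the flow conserves `M` and `S`, hence is explicit: a kick of `p` along `q` and a rotation. A
linear shear gives the other `s`, and the powers of `L` for several `s` supply all the generators
needed. Two flows remove the quartic terms (`reducesTo_gaudin_normalForm`); cubic flows act
additively below order seven, so the sextic terms are a linear problem
(`reducesTo_cubic_normalForm`). All maps preserve `S`, and `M`, `N` to second order, so the
quadratic part is preserved for every parameter. -/

/-! ### Rotation invariants and order of vanishing. -/

/-- The invariant `Q = q₁ p₁ + q₂ p₂`, which with `S`, `M`, `N` generates the rotation invariants. -/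
def hilbertQ (u : CanonicalSpace) : ℝ := u 0 * u 2 + u 1 * u 3

/-- `F` is of order at least `k` at the origin. -/
def VanishesToOrder (k : ℕ) (F : CanonicalSpace → ℝ) : Prop :=
  F =O[𝓝 0] (fun u => ‖u‖ ^ k)

namespace VanishesToOrder

variable {k l : ℕ} {F G : CanonicalSpace → ℝ}

theorem add (hF : VanishesToOrder k F) (hG : VanishesToOrder k G) :
    VanishesToOrder k (fun u => F u + G u) := IsBigO.add hF hG

theorem sub (hF : VanishesToOrder k F) (hG : VanishesToOrder k G) :
    VanishesToOrder k (fun u => F u - G u) := IsBigO.sub hF hG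

theorem neg (hF : VanishesToOrder k F) : VanishesToOrder k (fun u => -F u) := IsBigO.neg_left hF

theorem const_mul (c : ℝ) (hF : VanishesToOrder k F) : VanishesToOrder k (fun u => c * F u) :=
  IsBigO.const_mul_left hF c

theorem mul (hF : VanishesToOrder k F) (hG : VanishesToOrder l G) :
    VanishesToOrder (k + l) (fun u => F u * G u) := by
  have h := IsBigO.mul hF hG
  unfold VanishesToOrder
  simpa only [pow_add] using h

theorem mono (hF : VanishesToOrder k F) (h : l ≤ k) : VanishesToOrder l F := by
  refine IsBigO.trans hF (IsBigO.of_bound 1 ?_)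
  have : ∀ᶠ u : CanonicalSpace in 𝓝 0, ‖u‖ < 1 := by
    filter_upwards [Metric.ball_mem_nhds (0 : CanonicalSpace) one_pos] with u hu
    simpa using hu
  filter_upwards [this] with u hu
  rw [one_mul, norm_pow, norm_pow, norm_norm]
  exact pow_le_pow_of_le_one (norm_nonneg u) hu.le h

theorem congr (hF : VanishesToOrder k F) (h : ∀ u, F u = G u) : VanishesToOrder k G :=
  (funext h : F = G) ▸ hF

theorem comp (hF : VanishesToOrder k F) {Φ : CanonicalSpace → CanonicalSpace} (h0 : Φ 0 = 0)
    (hΦ : DifferentiableAt ℝ Φ 0) : VanishesToOrder k (fun u => F (Φ u)) := by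
  have hc : Filter.Tendsto Φ (𝓝 0) (𝓝 0) := by
    have := hΦ.continuousAt.tendsto
    rwa [h0] at this
  have h1 : Φ =O[𝓝 0] (fun u => u) := by
    have := hΦ.hasFDerivAt.isBigO_sub
    simpa [h0] using this
  exact (IsBigO.comp_tendsto hF hc).trans (h1.norm_norm.pow k)

end VanishesToOrder

theorem vanishesToOrder_zero (k : ℕ) : VanishesToOrder k (fun _ => 0) := isBigO_zero _ _

theorem vanishesToOrder_apply (i : Fin 4) : VanishesToOrder 1 (fun u => u i) := by
  refine IsBigO.of_bound 1 (Filter.Eventually.of_forall fun u => ?_)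
  simpa using norm_le_pi_norm u i

theorem vanishesToOrder_hilbertS : VanishesToOrder 2 hilbertS :=
  ((vanishesToOrder_apply 0).mul (vanishesToOrder_apply 3)).sub
    ((vanishesToOrder_apply 1).mul (vanishesToOrder_apply 2))

theorem vanishesToOrder_hilbertQ : VanishesToOrder 2 hilbertQ :=
  ((vanishesToOrder_apply 0).mul (vanishesToOrder_apply 2)).add
    ((vanishesToOrder_apply 1).mul (vanishesToOrder_apply 3))

theorem vanishesToOrder_hilbertM : VanishesToOrder 2 hilbertM :=
  ((((vanishesToOrder_apply 0).mul (vanishesToOrder_apply 0)).add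
    ((vanishesToOrder_apply 1).mul (vanishesToOrder_apply 1))).const_mul (1 / 2)).congr
    fun u => by unfold hilbertM; ring

theorem vanishesToOrder_hilbertN : VanishesToOrder 2 hilbertN :=
  ((((vanishesToOrder_apply 2).mul (vanishesToOrder_apply 2)).add
    ((vanishesToOrder_apply 3).mul (vanishesToOrder_apply 3))).const_mul (1 / 2)).congr
    fun u => by unfold hilbertN; ring

/-- Lagrange's identity in the plane. It eliminates `Q²`, and is how removing one monomial can
produce powers of `S`. -/
theorem hilbertQ_sq (u : CanonicalSpace) :
    hilbertQ u ^ 2 = 4 * hilbertM u * hilbertN u - hilbertS u ^ 2 := by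
  unfold hilbertQ hilbertM hilbertN hilbertS; ring

/-! ### Symplectic maps: shears, scalings and twists. -/

/-- A smooth injective map of `ℝ⁴` that fixes the origin and preserves the standard symplectic
form. -/
structure IsSymplecticMap (Φ : CanonicalSpace → CanonicalSpace) : Prop where
  contDiff : ContDiff ℝ ∞ Φ
  injective : Function.Injective Φ
  map_zero : Φ 0 = 0
  symplectic : ∀ u a b : CanonicalSpace,
    standardForm (fderiv ℝ Φ u a) (fderiv ℝ Φ u b) = standardForm a b

namespace IsSymplecticMap

variable {Φ Ψ : CanonicalSpace → CanonicalSpace}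

theorem differentiable (h : IsSymplecticMap Φ) : Differentiable ℝ Φ :=
  h.contDiff.differentiable (by simp)

theorem comp (hΦ : IsSymplecticMap Φ) (hΨ : IsSymplecticMap Ψ) :
    IsSymplecticMap (fun u => Φ (Ψ u)) where
  contDiff := hΦ.contDiff.comp hΨ.contDiff
  injective := hΦ.injective.comp hΨ.injective
  map_zero := by rw [hΨ.map_zero, hΦ.map_zero]
  symplectic u a b := by
    have : fderiv ℝ (fun u => Φ (Ψ u)) u = (fderiv ℝ Φ (Ψ u)).comp (fderiv ℝ Ψ u) :=
      fderiv_comp u (hΦ.differentiable _) (hΨ.differentiable u)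
    rw [this, ContinuousLinearMap.comp_apply, ContinuousLinearMap.comp_apply, hΦ.symplectic,
      hΨ.symplectic]

theorem of_linear (T : CanonicalSpace →L[ℝ] CanonicalSpace) (hT : Function.Injective T)
    (h : ∀ a b, standardForm (T a) (T b) = standardForm a b) : IsSymplecticMap T where
  contDiff := T.contDiff
  injective := hT
  map_zero := T.map_zero
  symplectic u a b := by rw [T.fderiv]; exact h a b

end IsSymplecticMap

/-- The linear shear `(q, p) ↦ (q + s p, p)`. -/
noncomputable def shear (s : ℝ) : CanonicalSpace →L[ℝ] CanonicalSpace :=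
  LinearMap.toContinuousLinearMap
    { toFun := fun u => ![u 0 + s * u 2, u 1 + s * u 3, u 2, u 3]
      map_add' := fun u v => by
        ext i; fin_cases i <;> simp <;> ring
      map_smul' := fun c u => by
        ext i; fin_cases i <;> simp <;> ring }

theorem shear_apply (s : ℝ) (u : CanonicalSpace) :
    shear s u = ![u 0 + s * u 2, u 1 + s * u 3, u 2, u 3] := rfl

theorem shear_neg_shear (s : ℝ) (u : CanonicalSpace) : shear (-s) (shear s u) = u := by
  ext i; fin_cases i <;> simp [shear_apply]

theorem isSymplecticMap_shear (s : ℝ) : IsSymplecticMap (shear s) :=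
  .of_linear _ (fun u v h => by rw [← shear_neg_shear s u, h, shear_neg_shear])
    fun a b => by simp [standardForm, shear_apply]; ring

/-- The linear scaling `(q, p) ↦ (c q, p / c)`. -/
noncomputable def scaling (c : ℝ) : CanonicalSpace →L[ℝ] CanonicalSpace :=
  LinearMap.toContinuousLinearMap
    { toFun := fun u => ![c * u 0, c * u 1, c⁻¹ * u 2, c⁻¹ * u 3]
      map_add' := fun u v => by
        ext i; fin_cases i <;> simp <;> ring
      map_smul' := fun c u => by
        ext i; fin_cases i <;> simp <;> ring }

theorem scaling_apply (c : ℝ) (u : CanonicalSpace) :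
    scaling c u = ![c * u 0, c * u 1, c⁻¹ * u 2, c⁻¹ * u 3] := rfl

theorem isSymplecticMap_scaling {c : ℝ} (hc : c ≠ 0) : IsSymplecticMap (scaling c) :=
  .of_linear _ (fun u v h => by
      have h' := fun i => congrFun h i
      simp only [scaling_apply] at h'
      ext i
      have := h' i
      fin_cases i <;> simpa [hc] using this)
    fun a b => by simp [standardForm, scaling_apply]; field_simp

theorem hilbertS_scaling {c : ℝ} (hc : c ≠ 0) (u : CanonicalSpace) :
    hilbertS (scaling c u) = hilbertS u := by
  simp [hilbertS, scaling_apply]; field_simp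

theorem hilbertM_scaling (c : ℝ) (u : CanonicalSpace) :
    hilbertM (scaling c u) = c ^ 2 * hilbertM u := by
  simp [hilbertM, scaling_apply]; ring

theorem hilbertN_scaling (c : ℝ) (u : CanonicalSpace) :
    hilbertN (scaling c u) = (c ^ 2)⁻¹ * hilbertN u := by
  simp [hilbertN, scaling_apply]; ring

/-- `(q, p) ↦ (R q, R (p - κ q))` where `R` is the rotation by the angle `θ`. -/
noncomputable def twist (κ θ : ℝ) (u : CanonicalSpace) : CanonicalSpace :=
  ![Real.cos θ * u 0 - Real.sin θ * u 1,
    Real.sin θ * u 0 + Real.cos θ * u 1,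
    Real.cos θ * (u 2 - κ * u 0) - Real.sin θ * (u 3 - κ * u 1),
    Real.sin θ * (u 2 - κ * u 0) + Real.cos θ * (u 3 - κ * u 1)]

theorem hilbertM_twist (κ θ : ℝ) (u : CanonicalSpace) : hilbertM (twist κ θ u) = hilbertM u := by
  simp [hilbertM, twist]
  linear_combination (u 0 ^ 2 + u 1 ^ 2) * Real.sin_sq_add_cos_sq θ

theorem hilbertS_twist (κ θ : ℝ) (u : CanonicalSpace) : hilbertS (twist κ θ u) = hilbertS u := by
  simp [hilbertS, twist]
  linear_combination (u 0 * u 3 - u 1 * u 2) * Real.sin_sq_add_cos_sq θ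

theorem hilbertN_twist (κ θ : ℝ) (u : CanonicalSpace) :
    hilbertN (twist κ θ u) = hilbertN u - κ * hilbertQ u + κ ^ 2 * hilbertM u := by
  simp [hilbertN, hilbertQ, hilbertM, twist]
  linear_combination ((u 2 - κ * u 0) ^ 2 + (u 3 - κ * u 1) ^ 2) / 2 * Real.sin_sq_add_cos_sq θ

theorem hilbertQ_twist (κ θ : ℝ) (u : CanonicalSpace) :
    hilbertQ (twist κ θ u) = hilbertQ u - 2 * κ * hilbertM u := by
  simp [hilbertQ, hilbertM, twist]
  linear_combination (u 0 * (u 2 - κ * u 0) + u 1 * (u 3 - κ * u 1)) * Real.sin_sq_add_cos_sq θ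

theorem twist_injective (κ θ : ℝ) : Function.Injective (twist κ θ) := by
  intro u v h
  have e : ∀ i, twist κ θ u i = twist κ θ v i := fun i => congrFun h i
  have e0 := e 0
  have e1 := e 1
  have e2 := e 2
  have e3 := e 3
  simp [twist] at e0 e1 e2 e3
  have hcs := Real.sin_sq_add_cos_sq θ
  have h0 : u 0 = v 0 := by
    linear_combination Real.cos θ * e0 + Real.sin θ * e1 - (u 0 - v 0) * hcs
  have h1 : u 1 = v 1 := by
    linear_combination Real.cos θ * e1 - Real.sin θ * e0 - (u 1 - v 1) * hcs
  rw [h0, h1] at e2 e3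
  have h2 : u 2 = v 2 := by
    linear_combination Real.cos θ * e2 + Real.sin θ * e3 - (u 2 - v 2) * hcs
  have h3 : u 3 = v 3 := by
    linear_combination Real.cos θ * e3 - Real.sin θ * e2 - (u 3 - v 3) * hcs
  ext i; fin_cases i <;> assumption

theorem hasFDerivAt_apply_four (i : Fin 4) (u : CanonicalSpace) :
    HasFDerivAt (fun v : CanonicalSpace => v i)
      (ContinuousLinearMap.proj (R := ℝ) (φ := fun _ : Fin 4 => ℝ) i) u :=
  (ContinuousLinearMap.proj (R := ℝ) (φ := fun _ : Fin 4 => ℝ) i).hasFDerivAt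

theorem fderiv_pi_apply {Φ : CanonicalSpace → CanonicalSpace} {u : CanonicalSpace}
    (hΦ : DifferentiableAt ℝ Φ u) {i : Fin 4} {D : CanonicalSpace →L[ℝ] ℝ}
    (h : HasFDerivAt (fun v => Φ v i) D u) (a : CanonicalSpace) : fderiv ℝ Φ u a i = D a := by
  have h1 := (hasFDerivAt_pi'.1 hΦ.hasFDerivAt) i
  exact congrArg (fun T : CanonicalSpace →L[ℝ] ℝ => T a) (h1.unique h)

/-- The map generated by `f(M, S)`, where `κ = ∂f/∂M` and `θ = ∂f/∂S`, is symplectic. The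
symmetry of the second derivatives of `f` is the only condition. -/
theorem standardForm_fderiv_twist {κ θ : CanonicalSpace → ℝ} {u : CanonicalSpace}
    {κ' θ' : CanonicalSpace →L[ℝ] ℝ} (hκ : HasFDerivAt κ κ' u) (hθ : HasFDerivAt θ θ' u)
    (x y z : ℝ)
    (hκ' : ∀ a, κ' a = x * (u 0 * a 0 + u 1 * a 1)
      + y * (u 0 * a 3 + u 3 * a 0 - u 1 * a 2 - u 2 * a 1))
    (hθ' : ∀ a, θ' a = y * (u 0 * a 0 + u 1 * a 1)
      + z * (u 0 * a 3 + u 3 * a 0 - u 1 * a 2 - u 2 * a 1))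
    (hd : DifferentiableAt ℝ (fun v => twist (κ v) (θ v) v) u) (a b : CanonicalSpace) :
    standardForm (fderiv ℝ (fun v => twist (κ v) (θ v) v) u a)
      (fderiv ℝ (fun v => twist (κ v) (θ v) v) u b) = standardForm a b := by
  have p := fun i => hasFDerivAt_apply_four i u
  have e0 := fderiv_pi_apply hd (i := 0) ((hθ.cos.mul (p 0)).sub (hθ.sin.mul (p 1)))
  have e1 := fderiv_pi_apply hd (i := 1) ((hθ.sin.mul (p 0)).add (hθ.cos.mul (p 1)))
  have e2 := fderiv_pi_apply hd (i := 2)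
    ((hθ.cos.mul ((p 2).sub (hκ.mul (p 0)))).sub (hθ.sin.mul ((p 3).sub (hκ.mul (p 1)))))
  have e3 := fderiv_pi_apply hd (i := 3)
    ((hθ.sin.mul ((p 2).sub (hκ.mul (p 0)))).add (hθ.cos.mul ((p 3).sub (hκ.mul (p 1)))))
  simp only [standardForm, e0, e1, e2, e3]
  simp [hκ', hθ']
  set C := Real.cos (θ u)
  set D := Real.sin (θ u)
  have hcs : C ^ 2 = 1 - D ^ 2 := by
    have := Real.sin_sq_add_cos_sq (θ u)
    simp only [C, D]; linarith
  -- The difference is a polynomial in cosine and sine; expanding first exposes the powers of the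
  -- cosine, which `hcs` then lowers.
  ring_nf
  simp only [hcs]
  ring

/-! ### Explicit flows of functions of `M + s Q + s² N` and `S`. -/

/-- The nilpotent quadratic form `M + s Q + s² N = |q + s p|² / 2`. -/
noncomputable def shearedM (s : ℝ) (u : CanonicalSpace) : ℝ :=
  hilbertM u + s * hilbertQ u + s ^ 2 * hilbertN u

theorem hilbertM_shear (s : ℝ) (u : CanonicalSpace) : hilbertM (shear s u) = shearedM s u := by
  simp [hilbertM, shearedM, hilbertQ, hilbertN, shear_apply]; ring

theorem hilbertS_shear (s : ℝ) (u : CanonicalSpace) : hilbertS (shear s u) = hilbertS u := by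
  simp [hilbertS, shear_apply]; ring

theorem hilbertN_shear (s : ℝ) (u : CanonicalSpace) : hilbertN (shear s u) = hilbertN u := by
  simp [hilbertN, shear_apply]

theorem hilbertQ_shear (s : ℝ) (u : CanonicalSpace) :
    hilbertQ (shear s u) = hilbertQ u + 2 * s * hilbertN u := by
  simp [hilbertQ, hilbertN, shear_apply]; ring

/-- Coefficients of a polynomial `f(M, S) = d₁ M S + d₂ M² + c₁ M S² + c₂ M² S + c₃ M³`. -/
structure Generator where
  d₁ : ℝ
  d₂ : ℝ
  c₁ : ℝ
  c₂ : ℝ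
  c₃ : ℝ

namespace Generator

variable (g : Generator)

/-- The partial derivative `∂f/∂M`. -/
def kappa (m x : ℝ) : ℝ :=
  g.d₁ * x + 2 * g.d₂ * m + g.c₁ * x ^ 2 + 2 * g.c₂ * m * x + 3 * g.c₃ * m ^ 2

/-- The partial derivative `∂f/∂S`. -/
def theta (m x : ℝ) : ℝ := g.d₁ * m + 2 * g.c₁ * m * x + g.c₂ * m ^ 2

/-- The time-one map of the Hamiltonian `f(M, S)`. -/
noncomputable def flow (u : CanonicalSpace) : CanonicalSpace :=
  twist (g.kappa (hilbertM u) (hilbertS u)) (g.theta (hilbertM u) (hilbertS u)) u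

/-- The time-one map of the Hamiltonian `f(M + s Q + s² N, S)`. -/
noncomputable def shearedFlow (s : ℝ) (u : CanonicalSpace) : CanonicalSpace :=
  shear (-s) (g.flow (shear s u))

theorem contDiff_flow : ContDiff ℝ ∞ g.flow := by
  rw [contDiff_pi]
  have hM : ContDiff ℝ ∞ hilbertM := by unfold hilbertM; fun_prop
  have hS : ContDiff ℝ ∞ hilbertS := by unfold hilbertS; fun_prop
  have hk : ContDiff ℝ ∞ (fun u => g.kappa (hilbertM u) (hilbertS u)) := by
    unfold kappa; fun_prop
  have hθ : ContDiff ℝ ∞ (fun u => g.theta (hilbertM u) (hilbertS u)) := by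
    unfold theta; fun_prop
  intro i
  fin_cases i <;> simp [flow, twist] <;> fun_prop

/-- The kick and the angle are the two partial derivatives of one polynomial, so the mixed
derivatives agree. Two points with the same image have the same `M` and `S`, hence the same kick and
angle, and a twist with fixed kick and angle is injective. -/
theorem isSymplecticMap_flow : IsSymplecticMap g.flow where
  contDiff := g.contDiff_flow
  injective u v h := by
    have hM : hilbertM u = hilbertM v := by
      have := congrArg hilbertM h
      rwa [flow, flow, hilbertM_twist, hilbertM_twist] at this
    have hS : hilbertS u = hilbertS v := by
      have := congrArg hilbertS h
      rwa [flow, flow, hilbertS_twist, hilbertS_twist] at this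
    rw [flow, flow, hM, hS] at h
    exact twist_injective _ _ h
  map_zero := by ext i; fin_cases i <;> simp [flow, twist]
  symplectic u a b := by
    have p := fun i => hasFDerivAt_apply_four i u
    have hM : HasFDerivAt hilbertM _ u := (((p 0).pow 2).add ((p 1).pow 2)).mul_const (2⁻¹ : ℝ)
    have hS : HasFDerivAt hilbertS _ u := ((p 0).mul (p 3)).sub ((p 1).mul (p 2))
    have hκ : HasFDerivAt (fun v => g.kappa (hilbertM v) (hilbertS v)) _ u :=
      ((((hS.const_mul g.d₁).add (hM.const_mul (2 * g.d₂))).add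
        ((hS.pow 2).const_mul g.c₁)).add ((hM.const_mul (2 * g.c₂)).mul hS)).add
        ((hM.pow 2).const_mul (3 * g.c₃))
    have hθ : HasFDerivAt (fun v => g.theta (hilbertM v) (hilbertS v)) _ u :=
      ((hM.const_mul g.d₁).add ((hM.const_mul (2 * g.c₁)).mul hS)).add
        ((hM.pow 2).const_mul g.c₂)
    -- The three numbers are the second derivatives of `f` in `MM`, `MS` and `SS`.
    refine standardForm_fderiv_twist hκ hθ
      (2 * g.d₂ + 2 * g.c₂ * hilbertS u + 6 * g.c₃ * hilbertM u)
      (g.d₁ + 2 * g.c₁ * hilbertS u + 2 * g.c₂ * hilbertM u)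
      (2 * g.c₁ * hilbertM u) (fun a => ?_) (fun a => ?_)
      (g.contDiff_flow.differentiable (by simp) u) a b
    · simp; ring
    · simp; ring

theorem isSymplecticMap_shearedFlow (s : ℝ) : IsSymplecticMap (g.shearedFlow s) :=
  (isSymplecticMap_shear (-s)).comp (g.isSymplecticMap_flow.comp (isSymplecticMap_shear s))

/-- `∂f/∂M` at `(M + s Q + s² N, S)`. -/
noncomputable def shearedKappa (s : ℝ) (u : CanonicalSpace) : ℝ :=
  g.kappa (shearedM s u) (hilbertS u)

theorem hilbertS_shearedFlow (s : ℝ) (u : CanonicalSpace) :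
    hilbertS (g.shearedFlow s u) = hilbertS u := by
  rw [shearedFlow, hilbertS_shear, flow, hilbertS_twist, hilbertS_shear]

/-- The Lie series of a quadratic invariant stops after the second bracket with the nilpotent form
`L`, so the pullback is exactly quadratic in the kick. The same holds for `Q` and `M` below. -/
theorem hilbertN_shearedFlow (s : ℝ) (u : CanonicalSpace) :
    hilbertN (g.shearedFlow s u) = hilbertN u
      - g.shearedKappa s u * (hilbertQ u + 2 * s * hilbertN u)
      + g.shearedKappa s u ^ 2 * shearedM s u := by
  rw [shearedFlow, hilbertN_shear, flow, hilbertN_twist, hilbertM_shear, hilbertS_shear,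
    hilbertN_shear, hilbertQ_shear, shearedKappa]

theorem hilbertQ_shearedFlow (s : ℝ) (u : CanonicalSpace) :
    hilbertQ (g.shearedFlow s u) = hilbertQ u
      + g.shearedKappa s u * (2 * s ^ 2 * hilbertN u - 2 * hilbertM u)
      - 2 * s * g.shearedKappa s u ^ 2 * shearedM s u := by
  rw [shearedFlow, hilbertQ_shear, flow, hilbertN_twist, hilbertQ_twist, hilbertM_shear,
    hilbertS_shear, hilbertN_shear, hilbertQ_shear, shearedKappa, shearedM]
  ring

theorem hilbertM_shearedFlow (s : ℝ) (u : CanonicalSpace) :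
    hilbertM (g.shearedFlow s u) = hilbertM u
      + g.shearedKappa s u * (s * (2 * hilbertM u + s * hilbertQ u))
      + s ^ 2 * g.shearedKappa s u ^ 2 * shearedM s u := by
  rw [shearedFlow, hilbertM_shear, shearedM, flow, hilbertN_twist, hilbertQ_twist, hilbertM_twist,
    hilbertM_shear, hilbertS_shear, hilbertN_shear, hilbertQ_shear, shearedKappa, shearedM]
  ring

end Generator

theorem vanishesToOrder_shearedM (s : ℝ) : VanishesToOrder 2 (shearedM s) :=
  (vanishesToOrder_hilbertM.add (vanishesToOrder_hilbertQ.const_mul s)).add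
    (vanishesToOrder_hilbertN.const_mul (s ^ 2))

/-! ### First-order effect of a flow on polynomials in the invariants. -/

/-- `X` has order at least `2 k`, and the terms of order less than `2 k + 4` of its pullback under
`E` are `X + Y`. -/
structure PullbackJet (E : CanonicalSpace → CanonicalSpace) (k : ℕ) (X Y : CanonicalSpace → ℝ) :
    Prop where
  vanishes : VanishesToOrder (2 * k) X
  vanishes_correction : VanishesToOrder (2 * k + 2) Y
  vanishes_remainder : VanishesToOrder (2 * k + 4) (fun u => X (E u) - X u - Y u)

namespace PullbackJet

variable {E : CanonicalSpace → CanonicalSpace} {k l : ℕ} {X Y X' Y' : CanonicalSpace → ℝ}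

theorem add (h : PullbackJet E k X Y) (h' : PullbackJet E k X' Y') :
    PullbackJet E k (fun u => X u + X' u) (fun u => Y u + Y' u) where
  vanishes := h.vanishes.add h'.vanishes
  vanishes_correction := h.vanishes_correction.add h'.vanishes_correction
  vanishes_remainder := (h.vanishes_remainder.add h'.vanishes_remainder).congr fun u => by ring

theorem const_mul (c : ℝ) (h : PullbackJet E k X Y) :
    PullbackJet E k (fun u => c * X u) (fun u => c * Y u) where
  vanishes := h.vanishes.const_mul c
  vanishes_correction := h.vanishes_correction.const_mul c
  vanishes_remainder := (h.vanishes_remainder.const_mul c).congr fun u => by ring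

/-- This is the Leibniz rule: the product of the two increments gains two orders from each factor
and so belongs to the remainder. -/
theorem mul (h : PullbackJet E k X Y) (h' : PullbackJet E l X' Y') :
    PullbackJet E (k + l) (fun u => X u * X' u) (fun u => Y u * X' u + X u * Y' u) where
  vanishes := (h.vanishes.mul h'.vanishes).mono (by lia)
  vanishes_correction := ((h.vanishes_correction.mul h'.vanishes).mono (by lia)).add
    ((h.vanishes.mul h'.vanishes_correction).mono (by lia))
  vanishes_remainder := by
    have hd : VanishesToOrder (2 * k + 2) (fun u => X (E u) - X u) :=
      ((h.vanishes_remainder.mono (by lia)).add h.vanishes_correction).congr fun u => by ring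
    have hd' : VanishesToOrder (2 * l + 2) (fun u => X' (E u) - X' u) :=
      ((h'.vanishes_remainder.mono (by lia)).add h'.vanishes_correction).congr fun u => by ring
    have e1 : VanishesToOrder (2 * (k + l) + 4)
        (fun u => (X (E u) - X u) * (X' (E u) - X' u)) := (hd.mul hd').mono (by lia)
    have e2 : VanishesToOrder (2 * (k + l) + 4)
        (fun u => (X (E u) - X u - Y u) * X' u) :=
      (h.vanishes_remainder.mul h'.vanishes).mono (by lia)
    have e3 : VanishesToOrder (2 * (k + l) + 4)
        (fun u => X u * (X' (E u) - X' u - Y' u)) :=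
      (h.vanishes.mul h'.vanishes_remainder).mono (by lia)
    exact ((e1.add e2).add e3).congr fun u => by ring

theorem congr (h : PullbackJet E k X Y) (hX : ∀ u, X u = X' u) (hY : ∀ u, Y u = Y' u) :
    PullbackJet E k X' Y' := (funext hX : X = X') ▸ (funext hY : Y = Y') ▸ h

theorem vanishes_sub (h : PullbackJet E k X Y) :
    VanishesToOrder (2 * k + 2) (fun u => X (E u) - X u) :=
  ((h.vanishes_remainder.mono (by lia)).add h.vanishes_correction).congr fun u => by ring

end PullbackJet

namespace Generator

variable (g : Generator) (s : ℝ)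

theorem vanishesToOrder_shearedKappa : VanishesToOrder 2 (g.shearedKappa s) := by
  have hL := vanishesToOrder_shearedM s
  have hS := vanishesToOrder_hilbertS
  exact ((((hS.const_mul g.d₁).add (hL.const_mul (2 * g.d₂))).add
    (((hS.mul hS).const_mul g.c₁).mono (by lia))).add
    (((hL.mul hS).const_mul (2 * g.c₂)).mono (by lia))).add
    (((hL.mul hL).const_mul (3 * g.c₃)).mono (by lia)) |>.congr fun u => by
      simp only [shearedKappa, kappa]; ring

theorem pullbackJet_hilbertS : PullbackJet (g.shearedFlow s) 1 hilbertS (fun _ => 0) where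
  vanishes := vanishesToOrder_hilbertS
  vanishes_correction := vanishesToOrder_zero _
  vanishes_remainder := (vanishesToOrder_zero _).congr fun u => by
    rw [g.hilbertS_shearedFlow]; ring

/-- The part of a pullback that is quadratic in the kick is always a multiple of `κ² L`. Its order
`6 = 2 · 1 + 4` makes it a remainder, so only the part linear in the kick is a correction. -/
theorem vanishesToOrder_sq_shearedKappa_mul (c : ℝ) :
    VanishesToOrder 6 (fun u => c * (g.shearedKappa s u * g.shearedKappa s u * shearedM s u)) :=
  (((g.vanishesToOrder_shearedKappa s).mul (g.vanishesToOrder_shearedKappa s)).mul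
    (vanishesToOrder_shearedM s)).const_mul c

theorem pullbackJet_hilbertN : PullbackJet (g.shearedFlow s) 1 hilbertN
    (fun u => -(g.shearedKappa s u * (hilbertQ u + 2 * s * hilbertN u))) where
  vanishes := vanishesToOrder_hilbertN
  vanishes_correction := ((g.vanishesToOrder_shearedKappa s).mul
    (vanishesToOrder_hilbertQ.add (vanishesToOrder_hilbertN.const_mul (2 * s)))).neg
  vanishes_remainder := (g.vanishesToOrder_sq_shearedKappa_mul s 1).congr fun u => by
    rw [g.hilbertN_shearedFlow]; ring

theorem pullbackJet_hilbertQ : PullbackJet (g.shearedFlow s) 1 hilbertQ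
    (fun u => g.shearedKappa s u * (2 * s ^ 2 * hilbertN u - 2 * hilbertM u)) where
  vanishes := vanishesToOrder_hilbertQ
  vanishes_correction := (g.vanishesToOrder_shearedKappa s).mul
    ((vanishesToOrder_hilbertN.const_mul (2 * s ^ 2)).sub (vanishesToOrder_hilbertM.const_mul 2))
  vanishes_remainder := (g.vanishesToOrder_sq_shearedKappa_mul s (-2 * s)).congr fun u => by
    rw [g.hilbertQ_shearedFlow]; ring

theorem pullbackJet_hilbertM : PullbackJet (g.shearedFlow s) 1 hilbertM
    (fun u => g.shearedKappa s u * (s * (2 * hilbertM u + s * hilbertQ u))) where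
  vanishes := vanishesToOrder_hilbertM
  vanishes_correction := (g.vanishesToOrder_shearedKappa s).mul
    (((vanishesToOrder_hilbertM.const_mul 2).add
      (vanishesToOrder_hilbertQ.const_mul s)).const_mul s)
  vanishes_remainder := (g.vanishesToOrder_sq_shearedKappa_mul s (s ^ 2)).congr fun u => by
    rw [g.hilbertM_shearedFlow]; ring

end Generator

/-! ### Normalizing maps and reduction modulo order seven. -/

/-- A symplectic map that preserves `S`, and preserves `M` and `N` to second order. -/
structure IsNormalizingMap (Φ : CanonicalSpace → CanonicalSpace) : Prop
    extends IsSymplecticMap Φ where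
  hilbertS_comp : ∀ u, hilbertS (Φ u) = hilbertS u
  hilbertM_comp : VanishesToOrder 4 (fun u => hilbertM (Φ u) - hilbertM u)
  hilbertN_comp : VanishesToOrder 4 (fun u => hilbertN (Φ u) - hilbertN u)

namespace IsNormalizingMap

theorem comp {Φ Ψ : CanonicalSpace → CanonicalSpace} (hΦ : IsNormalizingMap Φ)
    (hΨ : IsNormalizingMap Ψ) : IsNormalizingMap (fun u => Φ (Ψ u)) where
  toIsSymplecticMap := hΦ.toIsSymplecticMap.comp hΨ.toIsSymplecticMap
  hilbertS_comp u := by rw [hΦ.hilbertS_comp, hΨ.hilbertS_comp]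
  hilbertM_comp := ((hΦ.hilbertM_comp.comp hΨ.map_zero (hΨ.differentiable 0)).add
    hΨ.hilbertM_comp).congr fun u => by ring
  hilbertN_comp := ((hΦ.hilbertN_comp.comp hΨ.map_zero (hΨ.differentiable 0)).add
    hΨ.hilbertN_comp).congr fun u => by ring

theorem shearedFlow (g : Generator) (s : ℝ) : IsNormalizingMap (g.shearedFlow s) where
  toIsSymplecticMap := g.isSymplecticMap_shearedFlow s
  hilbertS_comp := g.hilbertS_shearedFlow s
  hilbertM_comp := (g.pullbackJet_hilbertM s).vanishes_sub
  hilbertN_comp := (g.pullbackJet_hilbertN s).vanishes_sub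

end IsNormalizingMap

/-- `F` is taken to `G` by a normalizing map, up to terms of order at least `7`. -/
def ReducesTo (F G : CanonicalSpace → ℝ) : Prop :=
  ∃ Φ, IsNormalizingMap Φ ∧ VanishesToOrder 7 (fun u => F (Φ u) - G u)

namespace ReducesTo

variable {F G K : CanonicalSpace → ℝ}

theorem trans (h : ReducesTo F G) (h' : ReducesTo G K) : ReducesTo F K := by
  obtain ⟨Φ, hΦ, hF⟩ := h
  obtain ⟨Ψ, hΨ, hG⟩ := h'
  exact ⟨_, hΦ.comp hΨ,
    ((hF.comp hΨ.map_zero (hΨ.differentiable 0)).add hG).congr fun u => by ring⟩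

theorem congr_right (h : ReducesTo F G) (hG : ∀ u, G u = K u) : ReducesTo F K :=
  (funext hG : G = K) ▸ h

end ReducesTo

/-- Effect of a sheared flow on `ρ S + n N + F₄ + F₆`, where `D₄` is the correction of `F₄`. -/
theorem reducesTo_shearedFlow (g : Generator) (s ρ n : ℝ) {F₄ D₄ F₆ D₆ : CanonicalSpace → ℝ}
    (h₄ : PullbackJet (g.shearedFlow s) 2 F₄ D₄) (h₆ : PullbackJet (g.shearedFlow s) 3 F₆ D₆) :
    ReducesTo (fun u => ρ * hilbertS u + n * hilbertN u + F₄ u + F₆ u)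
      (fun u => ρ * hilbertS u + n * hilbertN u
        + (F₄ u + -n * (g.shearedKappa s u * (hilbertQ u + 2 * s * hilbertN u)))
        + (F₆ u + (n * (g.shearedKappa s u * (g.shearedKappa s u * shearedM s u)) + D₄ u))) :=
  -- Both neglected parts have order `8`: the second-order change of `F₄` and the first-order change
  -- of `F₆`. The term `n κ² L` has order only `6` and must be kept.
  ⟨_, .shearedFlow g s, ((h₄.vanishes_remainder.add h₆.vanishes_sub).mono (by norm_num)).congr
    fun u => by
      beta_reduce
      rw [g.hilbertS_shearedFlow, g.hilbertN_shearedFlow]; ring⟩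

/-! ### Removal of the sextic terms. -/

/-- A cubic generator: the flow changes the invariants only in order at least `6`. -/
def Generator.IsCubic (g : Generator) : Prop := g.d₁ = 0 ∧ g.d₂ = 0

theorem Generator.IsCubic.vanishesToOrder_shearedKappa {g : Generator} (hg : g.IsCubic) (s : ℝ) :
    VanishesToOrder 4 (g.shearedKappa s) := by
  have hL := vanishesToOrder_shearedM s
  have hS := vanishesToOrder_hilbertS
  exact (((hS.mul hS).const_mul g.c₁).add ((hL.mul hS).const_mul (2 * g.c₂))).add
    ((hL.mul hL).const_mul (3 * g.c₃)) |>.congr fun u => by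
      simp only [Generator.shearedKappa, Generator.kappa, hg.1, hg.2]; ring

/-- `X` has order at least `2`, and every cubic flow changes it only in order at least `6`. -/
def IsSlow (X : CanonicalSpace → ℝ) : Prop :=
  VanishesToOrder 2 X ∧ ∀ g : Generator, g.IsCubic → ∀ s,
    VanishesToOrder 6 (fun u => X (g.shearedFlow s u) - X u)

/-- Every cubic flow changes `X` only in order at least `8`. -/
def IsStable (X : CanonicalSpace → ℝ) : Prop :=
  ∀ g : Generator, g.IsCubic → ∀ s, VanishesToOrder 8 (fun u => X (g.shearedFlow s u) - X u)

namespace IsStable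

variable {X Y : CanonicalSpace → ℝ}

theorem add (hX : IsStable X) (hY : IsStable Y) : IsStable (fun u => X u + Y u) :=
  fun g hg s => ((hX g hg s).add (hY g hg s)).congr fun u => by ring

theorem const_mul (c : ℝ) (hX : IsStable X) : IsStable (fun u => c * X u) :=
  fun g hg s => ((hX g hg s).const_mul c).congr fun u => by ring

end IsStable

namespace IsSlow

variable {X Y : CanonicalSpace → ℝ}

theorem add (hX : IsSlow X) (hY : IsSlow Y) : IsSlow (fun u => X u + Y u) :=
  ⟨hX.1.add hY.1, fun g hg s => ((hX.2 g hg s).add (hY.2 g hg s)).congr fun u => by ring⟩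

theorem const_mul (c : ℝ) (hX : IsSlow X) : IsSlow (fun u => c * X u) :=
  ⟨hX.1.const_mul c, fun g hg s => ((hX.2 g hg s).const_mul c).congr fun u => by ring⟩

theorem isStable_mul (hX : IsSlow X) (hY : IsSlow Y) : IsStable (fun u => X u * Y u) := by
  intro g hg s
  have e1 := ((hX.2 g hg s).mul (hY.2 g hg s)).mono (l := 8) (by norm_num)
  have e2 := (hX.2 g hg s).mul hY.1
  have e3 := hX.1.mul (hY.2 g hg s)
  exact ((e1.add e2).add e3).congr fun u => by ring

theorem mul (hX : IsSlow X) (hY : IsSlow Y) : IsSlow (fun u => X u * Y u) :=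
  ⟨(hX.1.mul hY.1).mono (by norm_num),
    fun g hg s => (hX.isStable_mul hY g hg s).mono (by norm_num)⟩

theorem hilbertS : IsSlow hilbertS :=
  ⟨vanishesToOrder_hilbertS, fun g _ s => (vanishesToOrder_zero 6).congr fun u => by
    rw [g.hilbertS_shearedFlow]; ring⟩

theorem hilbertN : IsSlow hilbertN := by
  refine ⟨vanishesToOrder_hilbertN, fun g hg s => ?_⟩
  have hκ := hg.vanishesToOrder_shearedKappa s
  exact ((hκ.mul (vanishesToOrder_hilbertQ.add (vanishesToOrder_hilbertN.const_mul (2 * s)))).neg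
    |>.add ((g.pullbackJet_hilbertN s).vanishes_remainder)).congr fun u => by ring

theorem hilbertQ : IsSlow hilbertQ := by
  refine ⟨vanishesToOrder_hilbertQ, fun g hg s => ?_⟩
  have hκ := hg.vanishesToOrder_shearedKappa s
  exact ((hκ.mul ((vanishesToOrder_hilbertN.const_mul (2 * s ^ 2)).sub
    (vanishesToOrder_hilbertM.const_mul 2))).add
    ((g.pullbackJet_hilbertQ s).vanishes_remainder)).congr fun u => by ring

theorem hilbertM : IsSlow hilbertM := by
  refine ⟨vanishesToOrder_hilbertM, fun g hg s => ?_⟩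
  have hκ := hg.vanishesToOrder_shearedKappa s
  exact ((hκ.mul (((vanishesToOrder_hilbertM.const_mul 2).add
      (vanishesToOrder_hilbertQ.const_mul s)).const_mul s)).add
    ((g.pullbackJet_hilbertM s).vanishes_remainder)).congr fun u => by ring

theorem shearedM (s : ℝ) : IsSlow (shearedM s) :=
  (hilbertM.add (hilbertQ.const_mul s)).add (hilbertN.const_mul (s ^ 2))

theorem shearedKappa {g : Generator} (hg : g.IsCubic) (s : ℝ) : IsSlow (g.shearedKappa s) := by
  have h := (((hilbertS.mul hilbertS).const_mul g.c₁).add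
    (((shearedM s).mul hilbertS).const_mul (2 * g.c₂))).add
    (((shearedM s).mul (shearedM s)).const_mul (3 * g.c₃))
  refine (funext fun u => ?_ : _ = g.shearedKappa s) ▸ h
  simp only [Generator.shearedKappa, Generator.kappa, hg.1, hg.2]; ring

end IsSlow

/-- The term `κ (Q + 2 s N)` by which a cubic flow changes `-N`. -/
noncomputable def Generator.change (g : Generator) (s : ℝ) (u : CanonicalSpace) : ℝ :=
  g.shearedKappa s u * (hilbertQ u + 2 * s * hilbertN u)

theorem Generator.IsCubic.isStable_change {g : Generator} (hg : g.IsCubic) (s : ℝ) :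
    IsStable (g.change s) :=
  (IsSlow.shearedKappa hg s).isStable_mul (IsSlow.hilbertQ.add (IsSlow.hilbertN.const_mul (2 * s)))

theorem Generator.IsCubic.reducesTo {g : Generator} (hg : g.IsCubic) (s ρ n : ℝ)
    {R : CanonicalSpace → ℝ} (hR : IsStable R) :
    ReducesTo (fun u => ρ * hilbertS u + n * hilbertN u + R u)
      (fun u => ρ * hilbertS u + n * hilbertN u + (R u + -n * g.change s u)) := by
  refine ⟨_, .shearedFlow g s, ?_⟩
  have h1 := (((hg.vanishesToOrder_shearedKappa s).mul (hg.vanishesToOrder_shearedKappa s)).mul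
    (vanishesToOrder_shearedM s)).const_mul n
  exact (((hR g hg s).mono (by norm_num)).add (h1.mono (by norm_num))).congr fun u => by
    beta_reduce
    rw [g.hilbertS_shearedFlow, g.hilbertN_shearedFlow, Generator.change]; ring

/-- What one cubic flow adds is stable under the next one, so successive flows do not interact below
order seven and their effects add up. Removing sextic terms thereby becomes linear algebra. -/
theorem reducesTo_sum_change (ρ n : ℝ) (l : List (Generator × ℝ)) (hl : ∀ x ∈ l, x.1.IsCubic)
    {R : CanonicalSpace → ℝ} (hR : IsStable R) (hne : l ≠ []) :
    ReducesTo (fun u => ρ * hilbertS u + n * hilbertN u + R u)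
      (fun u => ρ * hilbertS u + n * hilbertN u
        + (R u + -n * (l.map fun x => x.1.change x.2 u).sum)) := by
  induction l generalizing R with
  | nil => exact absurd rfl hne
  | cons x l ih =>
    have hx : x.1.IsCubic := hl x (by simp)
    have h1 := hx.reducesTo x.2 ρ n hR
    rcases eq_or_ne l [] with rfl | hl'
    · exact h1.congr_right fun u => by simp
    · refine (h1.trans (ih (fun y hy => hl y (by simp [hy]))
        (hR.add ((hx.isStable_change x.2).const_mul (-n))) hl')).congr_right fun u => ?_
      simp only [List.map_cons, List.sum_cons]; ring

/-- The part of a cubic polynomial in `M, N, Q, S` that is not in normal form. -/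
def cubicRemainder (g : Fin 12 → ℝ) (m n q x : ℝ) : ℝ :=
  g 0 * (m * (m * n)) + g 1 * (m * (n * n)) + g 2 * (n * (n * n)) + g 3 * (m * (m * q))
    + g 4 * (m * (n * q)) + g 5 * (n * (n * q)) + g 6 * (m * (n * x)) + g 7 * (n * (n * x))
    + g 8 * (m * (q * x)) + g 9 * (n * (q * x)) + g 10 * (n * (x * x)) + g 11 * (q * (x * x))

theorem isStable_cubicRemainder (g : Fin 12 → ℝ) : IsStable
    (fun u => cubicRemainder g (hilbertM u) (hilbertN u) (hilbertQ u) (hilbertS u)) := by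
  have M := IsSlow.hilbertM
  have N := IsSlow.hilbertN
  have Q := IsSlow.hilbertQ
  have S := IsSlow.hilbertS
  exact ((((((((((((M.isStable_mul (M.mul N)).const_mul (g 0)).add
    ((M.isStable_mul (N.mul N)).const_mul (g 1))).add
    ((N.isStable_mul (N.mul N)).const_mul (g 2))).add
    ((M.isStable_mul (M.mul Q)).const_mul (g 3))).add
    ((M.isStable_mul (N.mul Q)).const_mul (g 4))).add
    ((N.isStable_mul (N.mul Q)).const_mul (g 5))).add
    ((M.isStable_mul (N.mul S)).const_mul (g 6))).add
    ((N.isStable_mul (N.mul S)).const_mul (g 7))).add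
    ((M.isStable_mul (Q.mul S)).const_mul (g 8))).add
    ((N.isStable_mul (Q.mul S)).const_mul (g 9))).add
    ((N.isStable_mul (S.mul S)).const_mul (g 10))).add
    ((Q.isStable_mul (S.mul S)).const_mul (g 11))

/-- The generators, with their shears, that remove `cubicRemainder g`. -/
noncomputable def cubicGenerators (g : Fin 12 → ℝ) : List (Generator × ℝ) :=
  -- As polynomials in `s`, `L S²`, `L² S` and `L³` have degrees `2`, `4` and `6`; their top
  -- coefficients `N S²`, `N² S`, `N³` commute with `N` and are useless. So `2`, `4` and `6` values
  -- of `s` are needed, giving twelve unknowns for the twelve monomials of the remainder. The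
  -- entries solve this linear system.
  [(⟨0, 0, -g 1 / 10 + g 4 / 10 - g 10 / 2 + g 11, -g 6 / 24 + g 7 / 8 + g 8 / 2 - g 9 / 6,
      -g 0 / 90 + g 1 / 144 - g 2 / 72 + g 3 / 3 - g 4 / 24 + g 5 / 60⟩, 0),
    (⟨0, 0, g 1 / 10 + g 10 / 2, g 6 / 12 - g 7 / 8 + g 9 / 12,
      g 0 / 30 - 7 * g 1 / 720 + g 2 / 72 + g 4 / 45 - g 5 / 90⟩, 1),
    (⟨0, 0, 0, -g 6 / 36 - g 7 / 24 + g 9 / 12,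
      -g 0 / 60 - g 1 / 1440 + g 2 / 144 + g 4 / 45 - g 5 / 90⟩, -1),
    (⟨0, 0, 0, -g 6 / 72 + g 7 / 24,
      -g 0 / 120 + 7 * g 1 / 1440 - g 2 / 144 - g 4 / 720 + g 5 / 360⟩, 2),
    (⟨0, 0, 0, 0, g 0 / 600 - g 1 / 1440 - g 2 / 720 - g 4 / 720 + g 5 / 360⟩, -2),
    (⟨0, 0, 0, 0, g 0 / 900 - g 1 / 1440 + g 2 / 720⟩, 3)]

theorem sum_change_cubicGenerators (g : Fin 12 → ℝ) (u : CanonicalSpace) :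
    ((cubicGenerators g).map fun x => x.1.change x.2 u).sum
      = cubicRemainder g (hilbertM u) (hilbertN u) (hilbertQ u) (hilbertS u)
        - g 0 / 5 * (hilbertM u * hilbertS u ^ 2) - g 6 / 6 * hilbertS u ^ 3 := by
  simp only [cubicGenerators, List.map_cons, List.map_nil, List.sum_cons, List.sum_nil,
    Generator.change, Generator.shearedKappa, Generator.kappa, shearedM, cubicRemainder]
  -- The multipliers collect the terms of the sum that contain `Q²`. Eliminating them leaves the
  -- residues in `M S²` and `S³`.
  linear_combination (hilbertM u * g 0 / 5 + hilbertN u * g 1 / 5 + hilbertQ u * g 4 / 10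
    + hilbertS u * g 6 / 6) * hilbertQ_sq u

/-- The cubic flows solve the homological equation for the bracket with `n N`, whence the division
by `n`. The residues left by `Q² = 4 M N - S²` alter only the coefficients of `M S²` and `S³`; in
particular that of `M³` survives. -/
theorem reducesTo_cubic_normalForm (ρ n : ℝ) (hn : n ≠ 0) (a₄ a₅ a₆ a₇ a₈ a₉ : ℝ)
    (g : Fin 12 → ℝ) : ∃ b₈ b₉ : ℝ, ReducesTo
    (fun u => ρ * hilbertS u + n * hilbertN u
      + (a₄ * (hilbertM u * hilbertS u) + a₅ * (hilbertS u * hilbertS u)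
        + a₆ * (hilbertM u * (hilbertM u * hilbertM u))
        + a₇ * (hilbertM u * (hilbertM u * hilbertS u))
        + a₈ * (hilbertM u * (hilbertS u * hilbertS u))
        + a₉ * (hilbertS u * (hilbertS u * hilbertS u))
        + cubicRemainder g (hilbertM u) (hilbertN u) (hilbertQ u) (hilbertS u)))
    (fun u => ρ * hilbertS u + n * hilbertN u
      + a₄ * (hilbertM u * hilbertS u) + a₅ * hilbertS u ^ 2
      + a₆ * hilbertM u ^ 3 + a₇ * (hilbertM u ^ 2 * hilbertS u)
      + b₈ * (hilbertM u * hilbertS u ^ 2) + b₉ * hilbertS u ^ 3) := by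
  have M := IsSlow.hilbertM
  have S := IsSlow.hilbertS
  have hR := ((((((M.isStable_mul S).const_mul a₄).add ((S.isStable_mul S).const_mul a₅)).add
    ((M.isStable_mul (M.mul M)).const_mul a₆)).add
    ((M.isStable_mul (M.mul S)).const_mul a₇)).add
    ((M.isStable_mul (S.mul S)).const_mul a₈)).add
    ((S.isStable_mul (S.mul S)).const_mul a₉) |>.add (isStable_cubicRemainder g)
  refine ⟨a₈ + g 0 / 5, a₉ + g 6 / 6, (reducesTo_sum_change ρ n
    (cubicGenerators fun i => n⁻¹ * g i) ?_ hR (by simp [cubicGenerators])).congr_right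
    fun u => ?_⟩
  · intro x hx
    simp only [cubicGenerators, List.mem_cons, List.not_mem_nil, or_false] at hx
    rcases hx with rfl | rfl | rfl | rfl | rfl | rfl <;> exact ⟨rfl, rfl⟩
  · rw [sum_change_cubicGenerators]
    have : cubicRemainder (fun i => n⁻¹ * g i) (hilbertM u) (hilbertN u) (hilbertQ u) (hilbertS u)
        = n⁻¹ * cubicRemainder g (hilbertM u) (hilbertN u) (hilbertQ u) (hilbertS u) := by
      simp only [cubicRemainder]; ring
    rw [this]
    field_simp
    ring

/-! ### Removal of the quartic terms of the Gaudin Hamiltonian. -/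

theorem PullbackJet.neg {E : CanonicalSpace → CanonicalSpace} {k : ℕ} {X Y : CanonicalSpace → ℝ}
    (h : PullbackJet E k X Y) : PullbackJet E k (fun u => -X u) (fun u => -Y u) where
  vanishes := h.vanishes.neg
  vanishes_correction := h.vanishes_correction.neg
  vanishes_remainder := h.vanishes_remainder.neg.congr fun u => by ring

theorem pullbackJet_zero (E : CanonicalSpace → CanonicalSpace) (k : ℕ) :
    PullbackJet E k (fun _ => 0) (fun _ => 0) where
  vanishes := vanishesToOrder_zero _
  vanishes_correction := vanishesToOrder_zero _
  vanishes_remainder := (vanishesToOrder_zero _).congr fun u => by ring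

/-- Two sheared flows remove the terms of order four that are not in normal form from the
Hamiltonian of the rational Gaudin model, and cubic flows then remove those of order six. -/
theorem reducesTo_gaudin_normalForm (ρ a b : ℝ) : ∃ a₄ a₅ a₇ a₈ a₉ : ℝ, ReducesTo
    (fun u => ρ * hilbertS u + 2 * hilbertN u
      + (-(a / 4) * (hilbertN u * hilbertN u) + -(a / 4) * (hilbertM u * hilbertN u)
        + a / 8 * (hilbertS u * hilbertS u) + -(b / 8) * (hilbertN u * hilbertS u)
        + b / 8 * (hilbertM u * hilbertS u))
      + -(1 / 128) * ((hilbertN u + -1 * hilbertM u)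
        * ((b * hilbertM u + b * hilbertN u + a * hilbertS u)
          * (b * hilbertM u + b * hilbertN u + a * hilbertS u))))
    (fun u => ρ * hilbertS u + 2 * hilbertN u
      + a₄ * (hilbertM u * hilbertS u) + a₅ * hilbertS u ^ 2
      + b ^ 2 / 128 * hilbertM u ^ 3 + a₇ * (hilbertM u ^ 2 * hilbertS u)
      + a₈ * (hilbertM u * hilbertS u ^ 2) + a₉ * hilbertS u ^ 3) := by
  -- With opposite coefficients at `s` and `-s`, the squares of `L` combine to `4 s (M Q + s² N Q)`,
  -- whose bracket with `N` is `4 s (6 M N - S² + 2 s² N²)`. The terms `N²` and `M N` to be removed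
  -- have equal coefficients, which forces `s² = 3`. The terms `L S` combine to `2 s Q S`, with
  -- bracket `4 s N S`; matching sizes gives the coefficients of `g` and `g'`.
  obtain ⟨s, hs⟩ : ∃ s : ℝ, s ^ 2 = 3 := ⟨√3, Real.sq_sqrt (by norm_num)⟩
  set g : Generator := ⟨-(b * s / 192), -(a * s / 576), 0, 0, 0⟩ with hg
  set g' : Generator := ⟨b * s / 192, a * s / 576, 0, 0, 0⟩ with hg'
  have quartic (E Y Z) (N : PullbackJet E 1 hilbertN Y) (M : PullbackJet E 1 hilbertM Z)
      (S : PullbackJet E 1 hilbertS (fun _ => 0)) :=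
    (((((N.mul N).const_mul (-(a / 4))).add ((M.mul N).const_mul (-(a / 4)))).add
      ((S.mul S).const_mul (a / 8))).add ((N.mul S).const_mul (-(b / 8)))).add
      ((M.mul S).const_mul (b / 8))
  have sextic (E Y Z) (N : PullbackJet E 1 hilbertN Y) (M : PullbackJet E 1 hilbertM Z)
      (S : PullbackJet E 1 hilbertS (fun _ => 0)) :=
    have K := ((M.const_mul b).add (N.const_mul b)).add (S.const_mul a)
    ((N.add (M.const_mul (-1))).mul (K.mul K)).const_mul (-(1 / 128))
  have step := reducesTo_shearedFlow g s ρ 2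
    (quartic _ _ _ (g.pullbackJet_hilbertN s) (g.pullbackJet_hilbertM s)
      (g.pullbackJet_hilbertS s))
    (sextic _ _ _ (g.pullbackJet_hilbertN s) (g.pullbackJet_hilbertM s)
      (g.pullbackJet_hilbertS s))
  have N := g'.pullbackJet_hilbertN (-s)
  have M := g'.pullbackJet_hilbertM (-s)
  have Q := g'.pullbackJet_hilbertQ (-s)
  have S := g'.pullbackJet_hilbertS (-s)
  have O₂ := pullbackJet_zero (g'.shearedFlow (-s)) 2
  have L : PullbackJet (g'.shearedFlow (-s)) 1 (shearedM s) _ :=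
    (M.add (Q.const_mul s)).add (N.const_mul (s ^ 2))
  have K : PullbackJet (g'.shearedFlow (-s)) 1 (g.shearedKappa s) _ :=
    ((S.const_mul g.d₁).add (L.const_mul (2 * g.d₂))).congr
      (fun u => by simp [Generator.shearedKappa, Generator.kappa, hg]) fun u => rfl
  -- The second flow also acts on what the first one created: `K` is the first kick, and `dN`, `dM`,
  -- `dF` are the jets of the corrections to `N`, `M` and the quartic part.
  have dN := (K.mul (Q.add (N.const_mul (2 * s)))).neg
  have dM := K.mul (((M.const_mul 2).add (Q.const_mul s)).const_mul s)
  have dF := (((((dN.mul N).add (N.mul dN)).const_mul (-(a / 4))).add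
    (((dM.mul N).add (M.mul dN)).const_mul (-(a / 4)))).add
    (((O₂.mul S).add (S.mul O₂)).const_mul (a / 8))).add
    (((dN.mul S).add (N.mul O₂)).const_mul (-(b / 8))) |>.add
    (((dM.mul S).add (M.mul O₂)).const_mul (b / 8))
  have step' := reducesTo_shearedFlow g' (-s) ρ 2
    ((quartic _ _ _ N M S).add ((K.mul (Q.add (N.const_mul (2 * s)))).const_mul (-2)))
    ((sextic _ _ _ N M S).add (((K.mul (K.mul L)).const_mul 2).add dF))
  -- These are the coefficients after both quartic flows, reduced by `Q² = 4 M N - S²` and `s² = 3`;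
  -- the final `linear_combination` certifies the reduction. The coefficient of `M³` is still the
  -- original one.
  obtain ⟨b₈, b₉, hb⟩ := reducesTo_cubic_normalForm ρ 2 two_ne_zero (b / 8) (a / 12)
    (b ^ 2 / 128) (a * b / 96) (a ^ 2 / 96 - b ^ 2 / 128) (7 * a * b / 768)
    ![-a ^ 2 / 96 + b ^ 2 / 128, -b ^ 2 / 128, -a ^ 2 / 32 - b ^ 2 / 128, -s * a ^ 2 / 2304,
      s * a ^ 2 / 384, -s * a ^ 2 / 256, -7 * a * b / 128, -5 * a * b / 128, -s * a * b / 1152, 0,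
      -a ^ 2 / 96 - b ^ 2 / 256, -s * a ^ 2 / 2304 - s * b ^ 2 / 3072]
  refine ⟨_, _, _, _, _, (step.trans (step'.congr_right fun u => ?_)).trans hb⟩
  simp [Generator.shearedKappa, Generator.kappa, shearedM, cubicRemainder, hg, hg']
  linear_combination (
      1 / 3456 * hilbertM u * s ^ 4 * a ^ 2 - 1 / 576 * hilbertM u * s ^ 2 * a ^ 2 - 1 / 10368
      * hilbertN u * s ^ 6 * a ^ 2 + 1 / 576 * hilbertN u * s ^ 4 * a ^ 2 - 1 / 288 * hilbertN
      u * s ^ 2 * a ^ 2 + 1 / 20736 * hilbertQ u * s ^ 5 * a ^ 2 - 5 / 6912 * hilbertS u * s ^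
      4 * a * b - 1 / 1152 * hilbertS u * s ^ 2 * a * b + 1 / 72 * s ^ 2 * a) * hilbertQ_sq u + (
      1 / 864 * hilbertM u ^ 2 * hilbertN u * s ^ 2 * a ^ 2 - 1 / 288 * hilbertM u ^ 2 *
      hilbertN u * a ^ 2 - 1 / 6912 * hilbertM u ^ 2 * hilbertQ u * s * a ^ 2 - 1 / 576 *
      hilbertM u ^ 2 * hilbertS u * a * b + 1 / 144 * hilbertM u * hilbertN u ^ 2 * s ^ 2 * a
      ^ 2 + 1 / 3456 * hilbertM u * hilbertN u * hilbertQ u * s ^ 3 * a ^ 2 + 1 / 1152 *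
      hilbertM u * hilbertN u * hilbertQ u * s * a ^ 2 - 5 / 1152 * hilbertM u * hilbertN u *
      hilbertS u * s ^ 2 * a * b - 7 / 384 * hilbertM u * hilbertN u * hilbertS u * a * b + 1
      / 12 * hilbertM u * hilbertN u * a - 1 / 3456 * hilbertM u * hilbertQ u * hilbertS u * s
      * a * b - 1 / 3456 * hilbertM u * hilbertS u ^ 2 * s ^ 2 * a ^ 2 + 1 / 1152 * hilbertM u
      * hilbertS u ^ 2 * a ^ 2 - 1 / 384 * hilbertM u * hilbertS u ^ 2 * b ^ 2 + 1 / 2592 *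
      hilbertN u ^ 3 * s ^ 6 * a ^ 2 + 1 / 864 * hilbertN u ^ 3 * s ^ 4 * a ^ 2 - 1 / 288 *
      hilbertN u ^ 3 * s ^ 2 * a ^ 2 - 1 / 96 * hilbertN u ^ 3 * a ^ 2 - 1 / 6912 * hilbertN u
      ^ 2 * hilbertQ u * s ^ 5 * a ^ 2 - 1 / 2304 * hilbertN u ^ 2 * hilbertQ u * s ^ 3 * a ^
      2 - 1 / 768 * hilbertN u ^ 2 * hilbertQ u * s * a ^ 2 + 1 / 1152 * hilbertN u ^ 2 *
      hilbertS u * s ^ 4 * a * b + 1 / 1152 * hilbertN u ^ 2 * hilbertS u * s ^ 2 * a * b - 1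
      / 128 * hilbertN u ^ 2 * hilbertS u * a * b + 1 / 36 * hilbertN u ^ 2 * s ^ 2 * a + 1 /
      12 * hilbertN u ^ 2 * a + 1 / 10368 * hilbertN u * hilbertS u ^ 2 * s ^ 4 * a ^ 2 - 5 /
      3456 * hilbertN u * hilbertS u ^ 2 * s ^ 2 * a ^ 2 + 1 / 2304 * hilbertN u * hilbertS u
      ^ 2 * s ^ 2 * b ^ 2 - 1 / 1152 * hilbertN u * hilbertS u ^ 2 * a ^ 2 - 1 / 768 *
      hilbertN u * hilbertS u ^ 2 * b ^ 2 + 1 / 24 * hilbertN u * hilbertS u * b - 1 / 20736 *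
      hilbertQ u * hilbertS u ^ 2 * s ^ 3 * a ^ 2 - 1 / 6912 * hilbertQ u * hilbertS u ^ 2 * s
      * a ^ 2 - 1 / 9216 * hilbertQ u * hilbertS u ^ 2 * s * b ^ 2 + 5 / 6912 * hilbertS u ^ 3
      * s ^ 2 * a * b + 7 / 2304 * hilbertS u ^ 3 * a * b - 1 / 72 * hilbertS u ^ 2 * a) * hs

/-! ### Canonical coordinates on the product of spheres. -/

theorem hasFDerivAt_vec_three {E : Type*} [NormedAddCommGroup E] [NormedSpace ℝ E]
    {f₀ f₁ f₂ : E → ℝ} {D₀ D₁ D₂ : E →L[ℝ] ℝ} {u : E} (h₀ : HasFDerivAt f₀ D₀ u)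
    (h₁ : HasFDerivAt f₁ D₁ u) (h₂ : HasFDerivAt f₂ D₂ u) :
    HasFDerivAt (fun v => ![f₀ v, f₁ v, f₂ v]) (ContinuousLinearMap.pi ![D₀, D₁, D₂]) u := by
  refine hasFDerivAt_pi.2 fun i => ?_
  fin_cases i <;> simpa

/-- The scaling factor of `sphereChart`. -/
noncomputable def sphereFactor (R x y : ℝ) : ℝ := √((1 - (x ^ 2 + y ^ 2) / (8 * R)) / (2 * R))

/-- The area-preserving chart of the sphere around the north pole, which pulls `R ω_{S²}` back to
`(dx ∧ dy) / 2`. -/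
noncomputable def sphereChart (R x y : ℝ) : Fin 3 → ℝ :=
  ![x * sphereFactor R x y, y * sphereFactor R x y, 1 - (x ^ 2 + y ^ 2) / (4 * R)]

theorem sphereFactor_arg_pos {R x y : ℝ} (hR : 0 < R) (h : x ^ 2 + y ^ 2 < 8 * R) :
    0 < (1 - (x ^ 2 + y ^ 2) / (8 * R)) / (2 * R) := by
  have : (x ^ 2 + y ^ 2) / (8 * R) < 1 := (div_lt_one (by positivity)).2 h
  exact div_pos (by linarith) (by positivity)

theorem sphereFactor_sq {R x y : ℝ} (hR : 0 < R) (h : x ^ 2 + y ^ 2 < 8 * R) :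
    sphereFactor R x y ^ 2 = (1 - (x ^ 2 + y ^ 2) / (8 * R)) / (2 * R) :=
  Real.sq_sqrt (sphereFactor_arg_pos hR h).le

theorem sphereFactor_pos {R x y : ℝ} (hR : 0 < R) (h : x ^ 2 + y ^ 2 < 8 * R) :
    0 < sphereFactor R x y := Real.sqrt_pos.2 (sphereFactor_arg_pos hR h)

theorem sphereChart_mem {R x y : ℝ} (hR : 0 < R) (h : x ^ 2 + y ^ 2 < 8 * R) :
    sphereChart R x y 0 ^ 2 + sphereChart R x y 1 ^ 2 + sphereChart R x y 2 ^ 2 = 1 := by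
  have := sphereFactor_sq hR h
  simp only [sphereChart, Matrix.cons_val]
  rw [mul_pow, mul_pow, this]
  field_simp
  ring

theorem sphereChart_inj {R x y x' y' : ℝ} (hR : 0 < R) (h : x ^ 2 + y ^ 2 < 8 * R)
    (e : sphereChart R x y = sphereChart R x' y') : x = x' ∧ y = y' := by
  have e0 := congrFun e 0
  have e1 := congrFun e 1
  have e2 := congrFun e 2
  simp only [sphereChart, Matrix.cons_val] at e0 e1 e2
  have hr : x ^ 2 + y ^ 2 = x' ^ 2 + y' ^ 2 := by
    field_simp at e2; linarith
  have hf : sphereFactor R x y = sphereFactor R x' y' := by rw [sphereFactor, hr, sphereFactor]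
  rw [← hf] at e0 e1
  have := (sphereFactor_pos hR h).ne'
  exact ⟨mul_right_cancel₀ this e0, mul_right_cancel₀ this e1⟩

/-- Archimedes: in cylindrical coordinates the area form is `dφ ∧ dz`, and `z = 1 - r² / (4 R)`
turns `R dφ ∧ dz` into `(r dr ∧ dφ) / 2`. The scaling factor is the one that puts the point on the
sphere. -/
theorem hasFDerivAt_sphereChart {E : Type*} [NormedAddCommGroup E] [NormedSpace ℝ E]
    {R : ℝ} (hR : 0 < R) {X Y : E → ℝ} {X' Y' : E →L[ℝ] ℝ} {u : E} (hX : HasFDerivAt X X' u)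
    (hY : HasFDerivAt Y Y' u) (h : X u ^ 2 + Y u ^ 2 < 8 * R) :
    ∃ D : E →L[ℝ] (Fin 3 → ℝ), HasFDerivAt (fun v => sphereChart R (X v) (Y v)) D u ∧
      ∀ a b, R * (sphereChart R (X u) (Y u) ⬝ᵥ (D a ⨯₃ D b)) = (X' a * Y' b - X' b * Y' a) / 2 := by
  have hr := (hX.pow 2).add (hY.pow 2)
  have hpos := sphereFactor_pos hR h
  obtain ⟨f', hf, hk⟩ : ∃ f' : E →L[ℝ] ℝ,
      HasFDerivAt (fun v => sphereFactor R (X v) (Y v)) f' u ∧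
      ∀ c, sphereFactor R (X u) (Y u) * f' c = -(X u * X' c + Y u * Y' c) / (16 * R ^ 2) := by
    refine ⟨_, (((hr.mul_const (8 * R)⁻¹).const_sub 1).mul_const (2 * R)⁻¹).sqrt
      (sphereFactor_arg_pos hR h).ne', fun c => ?_⟩
    have : √((1 - (X u ^ 2 + Y u ^ 2) * (8 * R)⁻¹) * (2 * R)⁻¹) = sphereFactor R (X u) (Y u) := rfl
    simp only [Pi.add_apply, this]
    simp
    field_simp
    ring
  have hz := (hr.mul_const (4 * R)⁻¹).const_sub 1
  refine ⟨_, hasFDerivAt_vec_three (hX.mul hf) (hY.mul hf) hz, fun a b => ?_⟩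
  have hh := sphereFactor_sq hR h
  simp [sphereChart, cross_apply, dotProduct, Fin.sum_univ_three]
  set w := sphereFactor R (X u) (Y u)
  have ha := hk a
  have hb := hk b
  set z := 1 - (X u ^ 2 + Y u ^ 2) / (4 * R) with hz'
  set a2 := -(X u * X' a + Y u * Y' a) / (2 * R) with ha2
  set b2 := -(X u * X' b + Y u * Y' b) / (2 * R) with hb2
  -- The factor `w` enters the determinant only through `w²` and `w w'`, both rational functions of
  -- the coordinates, so no square root remains.
  have key : R * z * (X u * Y' b - Y u * X' b) * (-(X u * X' a + Y u * Y' a) / (16 * R ^ 2))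
      - R * z * (X u * Y' a - Y u * X' a) * (-(X u * X' b + Y u * Y' b) / (16 * R ^ 2))
      + R * (z * (X' a * Y' b - Y' a * X' b) + X u * (Y' a * b2 - a2 * Y' b)
        + Y u * (a2 * X' b - X' a * b2)) * ((1 - (X u ^ 2 + Y u ^ 2) / (8 * R)) / (2 * R))
      = (X' a * Y' b - X' b * Y' a) / 2 := by
    rw [hz', ha2, hb2]
    field_simp
    ring
  rw [← key, ← ha, ← hb, ← hh, hz', ha2, hb2]
  field_simp
  ring

/-- Canonical coordinates on `S² × S²` around `m₀`, adapted to the `1 : -1` resonance. -/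
noncomputable def gaudinChart (R₁ R₂ : ℝ) (u : CanonicalSpace) : GaudinAmbient :=
  (sphereChart R₁ (u 0 - u 3) (u 1 + u 2),
    ![sphereChart R₂ (-(u 0 + u 3)) (u 1 - u 2) 0, -sphereChart R₂ (-(u 0 + u 3)) (u 1 - u 2) 1,
      -sphereChart R₂ (-(u 0 + u 3)) (u 1 - u 2) 2])

/-- The domain of `gaudinChart`. -/
def gaudinChartDomain (R₁ R₂ : ℝ) : Set CanonicalSpace :=
  {u | (u 0 - u 3) ^ 2 + (u 1 + u 2) ^ 2 < 8 * R₁ ∧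
    (-(u 0 + u 3)) ^ 2 + (u 1 - u 2) ^ 2 < 8 * R₂}

theorem isOpen_gaudinChartDomain (R₁ R₂ : ℝ) : IsOpen (gaudinChartDomain R₁ R₂) :=
  (isOpen_lt (by fun_prop) (by fun_prop)).and (isOpen_lt (by fun_prop) (by fun_prop))

theorem contDiffOn_sphereChart {R : ℝ} (hR : 0 < R) {X Y : CanonicalSpace → ℝ}
    (hX : ContDiff ℝ ∞ X) (hY : ContDiff ℝ ∞ Y) {U : Set CanonicalSpace}
    (h : ∀ u ∈ U, X u ^ 2 + Y u ^ 2 < 8 * R) (i : Fin 3) :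
    ContDiffOn ℝ ∞ (fun u => sphereChart R (X u) (Y u) i) U := by
  have hf : ContDiffOn ℝ ∞ (fun u => sphereFactor R (X u) (Y u)) U :=
    ContDiffOn.sqrt (by fun_prop) fun u hu => (sphereFactor_arg_pos hR (h u hu)).ne'
  fin_cases i <;> simp [sphereChart] <;> fun_prop

/-- The second sphere is turned by `π` about the `x`-axis, which preserves area and carries the
north pole to the south pole. The linear change of variables makes the two halves `(dx ∧ dy) / 2`
add up to the standard form. -/
theorem isCanonicalCoordinates_gaudinChart {R₁ R₂ : ℝ} (hR₁ : 0 < R₁) (hR₂ : 0 < R₂) :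
    IsCanonicalCoordinates R₁ R₂ gaudinM0 (gaudinChartDomain R₁ R₂) (gaudinChart R₁ R₂) where
  isOpen := isOpen_gaudinChartDomain R₁ R₂
  zero_mem := by simp [gaudinChartDomain, hR₁, hR₂]
  map_zero := by simp [gaudinChart, sphereChart, gaudinM0]
  contDiffOn := by
    have h1 := contDiffOn_sphereChart hR₁ (X := fun u => u 0 - u 3) (Y := fun u => u 1 + u 2)
      (by fun_prop) (by fun_prop) (U := gaudinChartDomain R₁ R₂) fun u hu => hu.1
    have h2 := contDiffOn_sphereChart hR₂ (X := fun u => -(u 0 + u 3)) (Y := fun u => u 1 - u 2)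
      (by fun_prop) (by fun_prop) (U := gaudinChartDomain R₁ R₂) fun u hu => hu.2
    refine ContDiffOn.prodMk (contDiffOn_pi.2 h1) (contDiffOn_pi.2 fun i => ?_)
    fin_cases i
    · exact h2 0
    · exact (h2 1).neg
    · exact (h2 2).neg
  injOn u hu v hv h := by
    have h1 := congrArg Prod.fst h
    have h2 := congrArg Prod.snd h
    have e0 := congrFun h2 0
    have e1 := congrFun h2 1
    have e2 := congrFun h2 2
    simp only [gaudinChart, Matrix.cons_val, neg_inj] at e0 e1 e2
    have h1' := sphereChart_inj hR₁ hu.1 h1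
    have h2' := sphereChart_inj hR₂ hu.2 (x' := -(v 0 + v 3)) (y' := v 1 - v 2)
      (by ext i; fin_cases i <;> assumption)
    ext i
    fin_cases i <;> simp <;> linarith [h1'.1, h1'.2, h2'.1, h2'.2]
  mapsTo u hu := by
    refine ⟨sphereChart_mem hR₁ hu.1, ?_⟩
    have := sphereChart_mem hR₂ hu.2
    simpa [gaudinChart] using this
  symplectic u hu a b := by
    have p := fun i => hasFDerivAt_apply_four i u
    obtain ⟨D, hD, h⟩ := hasFDerivAt_sphereChart hR₁ ((p 0).sub (p 3)) ((p 1).add (p 2)) hu.1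
    obtain ⟨D', hD', h'⟩ := hasFDerivAt_sphereChart hR₂ ((p 0).add (p 3)).neg ((p 1).sub (p 2)) hu.2
    have q := hasFDerivAt_pi'.1 hD'
    have hψ : HasFDerivAt (gaudinChart R₁ R₂) _ u :=
      hD.prodMk (hasFDerivAt_vec_three (q 0) (q 1).neg (q 2).neg)
    rw [hψ.fderiv]
    have h1 := h a b
    have h2 := h' a b
    simp [cross_apply, dotProduct, Fin.sum_univ_three] at h1 h2
    simp [gaudinForm, gaudinChart, cross_apply, dotProduct, Fin.sum_univ_three, standardForm]
    linear_combination h1 + h2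

namespace IsCanonicalCoordinates

theorem comp {R₁ R₂ : ℝ} {z₀ : GaudinAmbient} {V U : Set CanonicalSpace}
    {ψ : CanonicalSpace → GaudinAmbient} {Φ : CanonicalSpace → CanonicalSpace}
    (h : IsCanonicalCoordinates R₁ R₂ z₀ V ψ) (hΦ : IsSymplecticMap Φ) (hU : IsOpen U)
    (h0 : (0 : CanonicalSpace) ∈ U) (hUV : MapsTo Φ U V) :
    IsCanonicalCoordinates R₁ R₂ z₀ U (fun u => ψ (Φ u)) where
  isOpen := hU
  zero_mem := h0
  map_zero := by rw [hΦ.map_zero, h.map_zero]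
  contDiffOn := h.contDiffOn.comp hΦ.contDiff.contDiffOn hUV
  injOn u hu v hv e := hΦ.injective (h.injOn (hUV hu) (hUV hv) e)
  mapsTo u hu := h.mapsTo (hUV hu)
  symplectic u hu a b := by
    have hd : DifferentiableAt ℝ ψ (Φ u) :=
      (h.contDiffOn.contDiffAt (h.isOpen.mem_nhds (hUV hu))).differentiableAt (by simp)
    have : fderiv ℝ (fun u => ψ (Φ u)) u = (fderiv ℝ ψ (Φ u)).comp (fderiv ℝ Φ u) :=
      fderiv_comp u hd (hΦ.differentiable u)
    rw [this, ContinuousLinearMap.comp_apply, ContinuousLinearMap.comp_apply,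
      h.symplectic _ (hUV hu), hΦ.symplectic]

end IsCanonicalCoordinates

/-! ### Taylor expansion of the Hamiltonian in the chart. -/

theorem gaudinJ_gaudinChart {R₁ R₂ : ℝ} (hR₁ : 0 < R₁) (hR₂ : 0 < R₂) (u : CanonicalSpace) :
    gaudinJ R₁ R₂ (gaudinChart R₁ R₂ u) = R₁ - R₂ + hilbertS u := by
  simp [gaudinJ, gaudinChart, sphereChart, hilbertS]
  field_simp
  ring

/-- The drop `1 - z₁` of the first height. -/
noncomputable def drop₁ (R₁ : ℝ) (u : CanonicalSpace) : ℝ :=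
  (hilbertM u + hilbertN u - hilbertS u) / (2 * R₁)

/-- The rise `1 + z₂` of the second height. -/
noncomputable def drop₂ (R₂ : ℝ) (u : CanonicalSpace) : ℝ :=
  (hilbertM u + hilbertN u + hilbertS u) / (2 * R₂)

theorem vanishesToOrder_drop₁ (R₁ : ℝ) : VanishesToOrder 2 (drop₁ R₁) :=
  (((vanishesToOrder_hilbertM.add vanishesToOrder_hilbertN).sub
    vanishesToOrder_hilbertS).const_mul (2 * R₁)⁻¹).congr fun u => by
      rw [drop₁, div_eq_inv_mul]

theorem vanishesToOrder_drop₂ (R₂ : ℝ) : VanishesToOrder 2 (drop₂ R₂) :=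
  (((vanishesToOrder_hilbertM.add vanishesToOrder_hilbertN).add
    vanishesToOrder_hilbertS).const_mul (2 * R₂)⁻¹).congr fun u => by
      rw [drop₂, div_eq_inv_mul]

/-- The squared radii in the two discs are `2 (M + N ∓ S)`, so the heights are affine in the
invariants. The turn of the second sphere changes `x₁ x₂ + y₁ y₂` into a difference, proportional to
`N - M`. -/
theorem rationalGaudinH_gaudinChart {R₁ R₂ : ℝ} (hR₁ : 0 < R₁) (hR₂ : 0 < R₂)
    (t₁ t₂ t₃ t₄ : ℝ) (u : CanonicalSpace) :
    rationalGaudinH t₁ t₂ t₃ t₄ (gaudinChart R₁ R₂ u) - rationalGaudinH t₁ t₂ t₃ t₄ gaudinM0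
      = (t₄ - t₁) * drop₁ R₁ u + (t₄ + t₂) * drop₂ R₂ u - t₄ * (drop₁ R₁ u * drop₂ R₂ u)
        + t₃ / √(R₁ * R₂) * ((hilbertN u - hilbertM u)
          * (√(1 - drop₁ R₁ u / 2) * √(1 - drop₂ R₂ u / 2))) := by
  have e1 : (u 0 - u 3) ^ 2 + (u 1 + u 2) ^ 2 = 4 * R₁ * drop₁ R₁ u := by
    unfold drop₁ hilbertM hilbertN hilbertS; field_simp; ring
  have e2 : (-(u 0 + u 3)) ^ 2 + (u 1 - u 2) ^ 2 = 4 * R₂ * drop₂ R₂ u := by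
    unfold drop₂ hilbertM hilbertN hilbertS; field_simp; ring
  have f1 : sphereFactor R₁ (u 0 - u 3) (u 1 + u 2) = √(1 - drop₁ R₁ u / 2) / √(2 * R₁) := by
    rw [sphereFactor, e1, Real.sqrt_div' _ (by positivity)]
    congr 3; field_simp; ring
  have f2 : sphereFactor R₂ (-(u 0 + u 3)) (u 1 - u 2) = √(1 - drop₂ R₂ u / 2) / √(2 * R₂) := by
    rw [sphereFactor, e2, Real.sqrt_div' _ (by positivity)]
    congr 3; field_simp; ring
  have hs : √(2 * R₁) * √(2 * R₂) = 2 * √(R₁ * R₂) := by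
    rw [← Real.sqrt_mul (by positivity), show 2 * R₁ * (2 * R₂) = 2 ^ 2 * (R₁ * R₂) by ring,
      Real.sqrt_mul (by positivity), Real.sqrt_sq (by norm_num)]
  have hp : √(R₁ * R₂) ≠ 0 := by positivity
  have hz1 : sphereChart R₁ (u 0 - u 3) (u 1 + u 2) 2 = 1 - drop₁ R₁ u := by
    simp only [sphereChart, Matrix.cons_val, e1]; field_simp
  have hz2 : sphereChart R₂ (-(u 0 + u 3)) (u 1 - u 2) 2 = 1 - drop₂ R₂ u := by
    simp only [sphereChart, Matrix.cons_val, e2]; field_simp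
  have hxy : sphereChart R₁ (u 0 - u 3) (u 1 + u 2) 0 * sphereChart R₂ (-(u 0 + u 3)) (u 1 - u 2) 0
      - sphereChart R₁ (u 0 - u 3) (u 1 + u 2) 1 * sphereChart R₂ (-(u 0 + u 3)) (u 1 - u 2) 1
      = (hilbertN u - hilbertM u) * (√(1 - drop₁ R₁ u / 2) * √(1 - drop₂ R₂ u / 2))
        / √(R₁ * R₂) := by
    have : √(1 - drop₁ R₁ u / 2) / √(2 * R₁) * (√(1 - drop₂ R₂ u / 2) / √(2 * R₂))
        = √(1 - drop₁ R₁ u / 2) * √(1 - drop₂ R₂ u / 2) / (2 * √(R₁ * R₂)) := by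
      rw [div_mul_div_comm, hs]
    simp only [sphereChart, Matrix.cons_val, f1, f2]
    have e3 : (u 0 - u 3) * -(u 0 + u 3) - (u 1 + u 2) * (u 1 - u 2)
        = 2 * (hilbertN u - hilbertM u) := by unfold hilbertN hilbertM; ring
    calc _ = ((u 0 - u 3) * -(u 0 + u 3) - (u 1 + u 2) * (u 1 - u 2))
          * (√(1 - drop₁ R₁ u / 2) / √(2 * R₁) * (√(1 - drop₂ R₂ u / 2) / √(2 * R₂))) := by ring
      _ = _ := by rw [this, e3]; field_simp
  simp only [rationalGaudinH, gaudinH, gaudinChart, gaudinM0, Matrix.cons_val, hz1, hz2]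
  linear_combination t₃ * hxy

/-- Multiplying by the conjugate gives exactly `-x³ (1 / 8 + x / 64)`, and the conjugate is bounded
below near `0`. -/
theorem isBigO_sqrt_one_sub :
    (fun x : ℝ => √(1 - x) - (1 - x / 2 - x ^ 2 / 8)) =O[𝓝 0] fun x => x ^ 3 := by
  refine IsBigO.of_bound 1 ?_
  filter_upwards [Metric.ball_mem_nhds (0 : ℝ) (half_pos one_pos)] with x hx
  have hx' : |x| < 1 / 2 := by simpa using hx
  obtain ⟨h1, h2⟩ := abs_lt.1 hx'
  have hs : √(1 - x) ^ 2 = 1 - x := Real.sq_sqrt (by linarith)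
  have h0 := Real.sqrt_nonneg (1 - x)
  have hp : 1 / 2 ≤ √(1 - x) + (1 - x / 2 - x ^ 2 / 8) := by nlinarith
  have he : (√(1 - x) - (1 - x / 2 - x ^ 2 / 8)) * (√(1 - x) + (1 - x / 2 - x ^ 2 / 8))
      = -(x ^ 3) * (1 / 8 + x / 64) := by linear_combination hs
  have ha : |√(1 - x) - (1 - x / 2 - x ^ 2 / 8)| * (√(1 - x) + (1 - x / 2 - x ^ 2 / 8))
      = |x ^ 3| * (1 / 8 + x / 64) := by
    rw [← abs_of_pos (show 0 < √(1 - x) + (1 - x / 2 - x ^ 2 / 8) by linarith), ← abs_mul, he,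
      abs_mul, abs_neg, abs_of_pos (show 0 < 1 / 8 + x / 64 by linarith)]
  rw [Real.norm_eq_abs, Real.norm_eq_abs, one_mul]
  have := abs_nonneg (x ^ 3)
  have := abs_nonneg (√(1 - x) - (1 - x / 2 - x ^ 2 / 8))
  nlinarith

theorem VanishesToOrder.tendsto {k : ℕ} (hk : k ≠ 0) {X : CanonicalSpace → ℝ}
    (hX : VanishesToOrder k X) : Filter.Tendsto X (𝓝 0) (𝓝 0) := by
  refine IsBigO.trans_tendsto hX ?_
  have : Filter.Tendsto (fun u : CanonicalSpace => ‖u‖ ^ k) (𝓝 0) (𝓝 (‖(0 : CanonicalSpace)‖ ^ k)) :=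
    (continuous_norm.pow k).tendsto 0
  simpa [hk] using this

theorem VanishesToOrder.sqrt_one_sub {X : CanonicalSpace → ℝ} (hX : VanishesToOrder 2 X) :
    VanishesToOrder 6 (fun u => √(1 - X u) - (1 - X u / 2 - X u ^ 2 / 8)) := by
  have h := isBigO_sqrt_one_sub.comp_tendsto (hX.tendsto two_ne_zero)
  refine h.trans ((IsBigO.pow hX 3).congr_right fun u => ?_)
  rw [← pow_mul]

theorem vanishesToOrder_const (c : ℝ) : VanishesToOrder 0 (fun _ => c) := by
  simpa [VanishesToOrder] using isBigO_const_const c (one_ne_zero (α := ℝ)) (𝓝 (0 : CanonicalSpace))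

theorem VanishesToOrder.sqrt_mul_sqrt {X Y : CanonicalSpace → ℝ} (hX : VanishesToOrder 2 X)
    (hY : VanishesToOrder 2 Y) : VanishesToOrder 6 (fun u => √(1 - X u) * √(1 - Y u)
      - (1 - (X u + Y u) / 2 - (X u - Y u) ^ 2 / 8)) := by
  have hp : ∀ {Z : CanonicalSpace → ℝ}, VanishesToOrder 2 Z →
      VanishesToOrder 0 (fun u => 1 - Z u / 2 - Z u ^ 2 / 8) := fun hZ =>
    (((vanishesToOrder_const 1).sub ((hZ.const_mul (1 / 2)).mono (by norm_num))).sub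
      (((hZ.mul hZ).const_mul (1 / 8)).mono (by norm_num))).congr fun u => by ring
  have eX := hX.sqrt_one_sub
  have eY := hY.sqrt_one_sub
  have h1 := eX.mul ((eY.mono (Nat.zero_le 6)).add (hp hY))
  have h2 := ((hp hX).mul eY).mono (l := 6) (by norm_num)
  -- `h3` and `h4` are the terms of degree three and four in the product of the two truncated
  -- series.
  have h3 := ((hX.mul (hX.mul hY)).const_mul (1 / 16)).add ((hX.mul (hY.mul hY)).const_mul (1 / 16))
  have h4 := (((hX.mul hX).mul (hY.mul hY)).const_mul (1 / 64)).mono (l := 6) (by norm_num)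
  exact (((h1.add h2).add h3).add h4).congr fun u => by ring

/-- The coefficient of `M + N` in the second order part of the Hamiltonian. -/
noncomputable def gaudinAlpha (R₁ R₂ t₁ t₂ t₄ : ℝ) : ℝ :=
  (t₄ - t₁) / (2 * R₁) + (t₄ + t₂) / (2 * R₂)

/-- The coefficient of `S` in the second order part of the Hamiltonian. -/
noncomputable def gaudinRho (R₁ R₂ t₁ t₂ t₄ : ℝ) : ℝ :=
  (t₄ + t₂) / (2 * R₂) - (t₄ - t₁) / (2 * R₁)

theorem rationalGaudinH_second_order {R₁ R₂ : ℝ} (hR₁ : 0 < R₁) (hR₂ : 0 < R₂)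
    (t₁ t₂ t₃ t₄ : ℝ) : VanishesToOrder 4 (fun u =>
      rationalGaudinH t₁ t₂ t₃ t₄ (gaudinChart R₁ R₂ u) - rationalGaudinH t₁ t₂ t₃ t₄ gaudinM0
        - (gaudinRho R₁ R₂ t₁ t₂ t₄ * hilbertS u
          + (gaudinAlpha R₁ R₂ t₁ t₂ t₄ + t₃ / √(R₁ * R₂)) * hilbertN u
          + (gaudinAlpha R₁ R₂ t₁ t₂ t₄ - t₃ / √(R₁ * R₂)) * hilbertM u)) := by
  have h1 := vanishesToOrder_drop₁ R₁
  have h2 := vanishesToOrder_drop₂ R₂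
  have hs := ((h1.const_mul (1 / 2)).sqrt_mul_sqrt (h2.const_mul (1 / 2))).mono (l := 2)
    (by norm_num)
  have hs' := ((hs.sub (((h1.const_mul (1 / 2)).add (h2.const_mul (1 / 2))).const_mul (1 / 2))).sub
    ((((((h1.const_mul (1 / 2)).sub (h2.const_mul (1 / 2)))).mul
      ((h1.const_mul (1 / 2)).sub (h2.const_mul (1 / 2)))).const_mul (1 / 8)).mono (by norm_num)))
  refine ((((vanishesToOrder_hilbertN.sub vanishesToOrder_hilbertM).mul hs').const_mul
    (t₃ / √(R₁ * R₂))).sub ((h1.mul h2).const_mul t₄)).congr fun u => ?_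
  rw [rationalGaudinH_gaudinChart hR₁ hR₂, gaudinRho, gaudinAlpha]
  rw [show 1 / 2 * drop₁ R₁ u = drop₁ R₁ u / 2 by ring,
    show 1 / 2 * drop₂ R₂ u = drop₂ R₂ u / 2 by ring]
  have e1 : drop₁ R₁ u = (hilbertM u + hilbertN u - hilbertS u) / (2 * R₁) := rfl
  have e2 : drop₂ R₂ u = (hilbertM u + hilbertN u + hilbertS u) / (2 * R₂) := rfl
  linear_combination (-(t₄ - t₁)) * e1 - (t₄ + t₂) * e2

/-- `hα` removes `M` from the quadratic part. In degree four, `-t₄` times the product of the drops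
contributes `-t₄ / (4 R₁ R₂)` to `M²` and the square roots contribute `a / 8` times `t₃ / √(R₁ R₂)`;
`ht₄` makes them cancel. The common factor is then pulled out of everything but the `S` term. -/
theorem rationalGaudinH_sixth_order {R₁ R₂ : ℝ} (hR₁ : 0 < R₁) (hR₂ : 0 < R₂)
    (t₁ t₂ t₃ t₄ a b : ℝ) (ha : a = 1 / R₁ + 1 / R₂) (hb : b = 1 / R₂ - 1 / R₁)
    (hα : gaudinAlpha R₁ R₂ t₁ t₂ t₄ = t₃ / √(R₁ * R₂))
    (ht₄ : t₄ = t₃ / √(R₁ * R₂) * (R₁ + R₂) / 2) : VanishesToOrder 8 (fun u =>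
      rationalGaudinH t₁ t₂ t₃ t₄ (gaudinChart R₁ R₂ u) - rationalGaudinH t₁ t₂ t₃ t₄ gaudinM0
        - (gaudinRho R₁ R₂ t₁ t₂ t₄ * hilbertS u + t₃ / √(R₁ * R₂) * (2 * hilbertN u
      + (-(a / 4) * (hilbertN u * hilbertN u) + -(a / 4) * (hilbertM u * hilbertN u)
        + a / 8 * (hilbertS u * hilbertS u) + -(b / 8) * (hilbertN u * hilbertS u)
        + b / 8 * (hilbertM u * hilbertS u))
      + -(1 / 128) * ((hilbertN u + -1 * hilbertM u)
        * ((b * hilbertM u + b * hilbertN u + a * hilbertS u)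
          * (b * hilbertM u + b * hilbertN u + a * hilbertS u)))))) := by
  have h1 := vanishesToOrder_drop₁ R₁
  have h2 := vanishesToOrder_drop₂ R₂
  have hs := ((h1.const_mul (1 / 2)).sqrt_mul_sqrt (h2.const_mul (1 / 2)))
  refine (((vanishesToOrder_hilbertN.sub vanishesToOrder_hilbertM).mul hs).const_mul
    (t₃ / √(R₁ * R₂))).congr fun u => ?_
  rw [rationalGaudinH_gaudinChart hR₁ hR₂]
  rw [show 1 / 2 * drop₁ R₁ u = drop₁ R₁ u / 2 by ring,
    show 1 / 2 * drop₂ R₂ u = drop₂ R₂ u / 2 by ring]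
  have hlin : (t₄ - t₁) * drop₁ R₁ u + (t₄ + t₂) * drop₂ R₂ u
      = gaudinAlpha R₁ R₂ t₁ t₂ t₄ * (hilbertM u + hilbertN u)
        + gaudinRho R₁ R₂ t₁ t₂ t₄ * hilbertS u := by
    unfold drop₁ drop₂ gaudinAlpha gaudinRho; ring
  have hprod : t₄ * (drop₁ R₁ u * drop₂ R₂ u)
      = t₃ / √(R₁ * R₂) * (a / 8) * ((hilbertM u + hilbertN u) ^ 2 - hilbertS u ^ 2) := by
    rw [ht₄, ha, drop₁, drop₂]; field_simp; ring
  have hsum : drop₁ R₁ u + drop₂ R₂ u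
      = (a * (hilbertM u + hilbertN u) + b * hilbertS u) / 2 := by
    rw [ha, hb, drop₁, drop₂]; field_simp; ring
  have hdiff : drop₁ R₁ u - drop₂ R₂ u
      = -(b * (hilbertM u + hilbertN u) + a * hilbertS u) / 2 := by
    rw [ha, hb, drop₁, drop₂]; field_simp; ring
  rw [hα] at hlin
  have e1 : (drop₁ R₁ u / 2 + drop₂ R₂ u / 2) / 2
      = (a * (hilbertM u + hilbertN u) + b * hilbertS u) / 8 := by
    linear_combination hsum / 4
  have e2 : (drop₁ R₁ u / 2 - drop₂ R₂ u / 2)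
      = -(b * (hilbertM u + hilbertN u) + a * hilbertS u) / 4 := by
    linear_combination hdiff / 2
  rw [e1, e2, hlin, hprod]
  ring

/-! ### Dependence on the parameter and proof of the theorem. -/

theorem contDiff_gaudinAlpha (R₁ R₂ t₁ t₂ : ℝ) : ContDiff ℝ ∞ (gaudinAlpha R₁ R₂ t₁ t₂) := by
  unfold gaudinAlpha; fun_prop

theorem contDiff_gaudinRho (R₁ R₂ t₁ t₂ : ℝ) : ContDiff ℝ ∞ (gaudinRho R₁ R₂ t₁ t₂) := by
  unfold gaudinRho; fun_prop

theorem hasDerivAt_gaudinAlpha (R₁ R₂ t₁ t₂ t : ℝ) :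
    HasDerivAt (gaudinAlpha R₁ R₂ t₁ t₂) (1 / (2 * R₁) + 1 / (2 * R₂)) t :=
  (((hasDerivAt_id t).sub_const t₁).div_const (2 * R₁)).add
    (((hasDerivAt_id t).add_const t₂).div_const (2 * R₂))

theorem contDiffOn_scaling {c : ℝ → ℝ} {W : Set ℝ} (hc : ContDiffOn ℝ ∞ c W)
    (h0 : ∀ t ∈ W, c t ≠ 0) :
    ContDiffOn ℝ ∞ (fun x : ℝ × CanonicalSpace => scaling (c x.1) x.2) (W ×ˢ univ) := by
  have h1 : ContDiffOn ℝ ∞ (fun x : ℝ × CanonicalSpace => c x.1) (W ×ˢ univ) :=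
    hc.comp contDiff_fst.contDiffOn fun x hx => hx.1
  have h2 : ContDiffOn ℝ ∞ (fun x : ℝ × CanonicalSpace => (c x.1)⁻¹) (W ×ˢ univ) :=
    h1.inv fun x hx => h0 _ hx.1
  rw [contDiffOn_pi]
  intro i
  fin_cases i
  · exact h1.mul (f := fun x => c x.1) (g := fun x : ℝ × CanonicalSpace => x.2 0) (by fun_prop)
  · exact h1.mul (f := fun x => c x.1) (g := fun x : ℝ × CanonicalSpace => x.2 1) (by fun_prop)
  · exact h2.mul (f := fun x => (c x.1)⁻¹) (g := fun x : ℝ × CanonicalSpace => x.2 2) (by fun_prop)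
  · exact h2.mul (f := fun x => (c x.1)⁻¹) (g := fun x : ℝ × CanonicalSpace => x.2 3) (by fun_prop)

/-- The pullback of a quadratic Hamiltonian `r S + k N + l M` by a scaling and a normalizing
map. -/
theorem VanishesToOrder.second_order_comp {F : CanonicalSpace → ℝ} {r k l c : ℝ} (hc : c ≠ 0)
    {Φ : CanonicalSpace → CanonicalSpace} (hΦ : IsNormalizingMap Φ)
    (hF : VanishesToOrder 4 (fun u => F u - (r * hilbertS u + k * hilbertN u + l * hilbertM u))) :
    VanishesToOrder 4 (fun u => F (Φ (scaling c u))
      - (r * hilbertS u + k * (c ^ 2)⁻¹ * hilbertN u + l * c ^ 2 * hilbertM u)) := by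
  have h1 := hF.comp hΦ.map_zero (hΦ.differentiable 0)
  have h2 := (h1.add (hΦ.hilbertN_comp.const_mul k)).add (hΦ.hilbertM_comp.const_mul l)
  refine (h2.comp (Φ := scaling c) (map_zero _) (scaling c).differentiableAt).congr fun u => ?_
  rw [hΦ.hilbertS_comp, hilbertS_scaling hc, hilbertN_scaling, hilbertM_scaling]
  ring

theorem fderiv_eq_zero_of_vanishesToOrder {F G : CanonicalSpace → ℝ} {c d : ℝ}
    (hF : VanishesToOrder 2 (fun u => F u - c)) (hG : VanishesToOrder 2 (fun u => G u - d)) :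
    fderiv ℝ (fun u => (F u, G u)) 0 = 0 := by
  have h : ∀ {F : CanonicalSpace → ℝ} {c : ℝ}, VanishesToOrder 2 (fun u => F u - c) →
      HasFDerivAt F (0 : CanonicalSpace →L[ℝ] ℝ) 0 := by
    intro F c hF
    have h1 : HasFDerivAt (fun u => F u - c) (0 : CanonicalSpace →L[ℝ] ℝ) 0 :=
      IsBigO.hasFDerivAt (n := 2) (by simpa [VanishesToOrder] using hF) (by norm_num)
    simpa using h1.add_const c
  have := ((h hF).prodMk (h hG)).fderiv
  rw [this]
  ext <;> simp

theorem corollary5p3 (R₁ R₂ t₁ t₂ t₃ : ℝ) (hR₁ : 0 < R₁) (hR₂ : 0 < R₂)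
    (hR : R₁ ≠ R₂)
    (ht₃ : t₃ = 2 * √(R₁ * R₂) * (R₂ * t₁ - R₁ * t₂) / (R₁ - R₂) ^ 2)
    (h₁ : R₁ * t₂ ≠ R₂ * t₁)
    (h₂ : R₁ * (t₁ + 2 * t₂) ≠ R₂ * (2 * t₁ + t₂))
    (h₃ : t₁ ≠ t₂) :
    DegenerateHamiltonianHopf R₁ R₂ (gaudinJ R₁ R₂)
      (fun t₄ => rationalGaudinH t₁ t₂ t₃ t₄) gaudinM0 (t4m0Plus R₁ R₂ 1 t₁ t₂ t₃) := by
  have hs0 : 0 < √(R₁ * R₂) := by positivity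
  have hs2 : √(R₁ * R₂) ^ 2 = R₁ * R₂ := Real.sq_sqrt (by positivity)
  have hR' : R₁ - R₂ ≠ 0 := sub_ne_zero.2 hR
  obtain ⟨β, hβ⟩ : ∃ β, β = t₃ / √(R₁ * R₂) := ⟨_, rfl⟩
  obtain ⟨τ, hτ⟩ : ∃ τ, τ = t4m0Plus R₁ R₂ 1 t₁ t₂ t₃ := ⟨_, rfl⟩
  have hβd : β * (R₁ - R₂) ^ 2 = 2 * (R₂ * t₁ - R₁ * t₂) := by
    rw [hβ, ht₃]; field_simp
  have hβ0 : β ≠ 0 := by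
    rintro rfl
    exact h₁ (by linarith)
  -- This is the vanishing of the coefficient of `M²`, and the place where the special value of `t₃`
  -- acts through `hβd`.
  have hτβ : τ = β * (R₁ + R₂) / 2 := by
    have : t₃ = β * √(R₁ * R₂) := by rw [hβ]; field_simp
    rw [hτ, t4m0Plus, this, div_eq_iff (by positivity)]
    linear_combination (-1 / 2) * hβd + 2 * β * hs2
  have hα : gaudinAlpha R₁ R₂ t₁ t₂ τ = β := by
    rw [gaudinAlpha, hτβ]
    field_simp
    linear_combination hβd
  have hρ : gaudinRho R₁ R₂ t₁ t₂ τ ≠ 0 := by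
    have : gaudinRho R₁ R₂ t₁ t₂ τ * (R₁ - R₂) = t₁ - t₂ := by
      rw [gaudinRho, hτβ]
      field_simp
      linear_combination (R₁ + R₂) * hβd
    intro h
    rw [h, zero_mul] at this
    exact h₃ (by linarith)
  obtain ⟨σ, hσ, hσβ⟩ : ∃ σ : ℝ, (σ = 1 ∨ σ = -1) ∧ 0 < σ * β := by
    rcases lt_or_gt_of_ne hβ0 with h | h
    · exact ⟨-1, .inr rfl, by linarith⟩
    · exact ⟨1, .inl rfl, by linarith⟩
  have hσ2 : σ ^ 2 = 1 := by rcases hσ with rfl | rfl <;> norm_num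
  have hσ0 : σ ≠ 0 := by rintro rfl; norm_num at hσ2
  obtain ⟨a, ha⟩ : ∃ a, a = 1 / R₁ + 1 / R₂ := ⟨_, rfl⟩
  obtain ⟨b, hb⟩ : ∃ b, b = 1 / R₂ - 1 / R₁ := ⟨_, rfl⟩
  have hb0 : b ≠ 0 := by
    rw [hb, div_sub_div _ _ hR₂.ne' hR₁.ne', one_mul, mul_one]
    exact div_ne_zero hR' (by positivity)
  set ρ := gaudinRho R₁ R₂ t₁ t₂ τ with hρdef
  -- The normal form is computed for the Hamiltonian divided by `β`, hence `ρ / β`.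
  obtain ⟨a₄, a₅, a₇, a₈, a₉, Φ, hΦ, hN⟩ := reducesTo_gaudin_normalForm (ρ / β) a b
  have hsix := rationalGaudinH_sixth_order hR₁ hR₂ t₁ t₂ t₃ τ a b ha hb (by rw [hα, hβ])
    (by rw [hτβ, hβ])
  rw [← hβ] at hsix
  -- On `W` the coefficient `α + β` of `N` keeps the sign `σ` of `β`, so scaling by the root of its
  -- absolute value is smooth and makes that coefficient `σ`.
  set W : Set ℝ := {t | 0 < σ * (gaudinAlpha R₁ R₂ t₁ t₂ t + β)} with hW
  have hcα := contDiff_gaudinAlpha R₁ R₂ t₁ t₂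
  have hWo : IsOpen W := isOpen_lt continuous_const
    (continuous_const.mul (hcα.continuous.add continuous_const))
  have hτW : τ ∈ W := by
    change 0 < σ * (gaudinAlpha R₁ R₂ t₁ t₂ τ + β)
    rw [hα]; linarith
  set c : ℝ → ℝ := fun t => √(σ * (gaudinAlpha R₁ R₂ t₁ t₂ t + β)) with hc
  have hc2 : ∀ t ∈ W, c t ^ 2 = σ * (gaudinAlpha R₁ R₂ t₁ t₂ t + β) := fun t ht =>
    Real.sq_sqrt (le_of_lt ht)
  have hc0 : ∀ t ∈ W, c t ≠ 0 := fun t ht => (Real.sqrt_pos.2 ht).ne'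
  have hcs : ContDiffOn ℝ ∞ c W := ContDiffOn.sqrt (by fun_prop) fun t ht => ht.ne'
  have hG : ContDiffOn ℝ ∞ (fun x : ℝ × CanonicalSpace => Φ (scaling (c x.1) x.2)) (W ×ˢ univ) :=
    hΦ.contDiff.comp_contDiffOn (contDiffOn_scaling hcs hc0)
  have hchart := isCanonicalCoordinates_gaudinChart hR₁ hR₂
  -- Balls for the product metric are products of balls, so one `ε` serves both for the parameter
  -- interval and for a coordinate domain common to all parameters.
  obtain ⟨ε, hε, hball⟩ : ∃ ε > 0, ∀ x ∈ Metric.ball ((τ, 0) : ℝ × CanonicalSpace) ε,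
      x.1 ∈ W ∧ Φ (scaling (c x.1) x.2) ∈ gaudinChartDomain R₁ R₂ := by
    have hnhds : W ×ˢ (univ : Set CanonicalSpace) ∈ 𝓝 (τ, 0) :=
      (hWo.prod isOpen_univ).mem_nhds ⟨hτW, mem_univ _⟩
    have hcont := hG.continuousOn.continuousAt hnhds
    have h0 : Φ (scaling (c τ) 0) ∈ gaudinChartDomain R₁ R₂ := by
      rw [map_zero, hΦ.map_zero]; exact hchart.zero_mem
    obtain ⟨ε, hε, h⟩ := Metric.eventually_nhds_iff_ball.1
      (Filter.Eventually.and hnhds (hcont.eventually (hchart.isOpen.mem_nhds h0)))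
    exact ⟨ε, hε, fun x hx => ⟨(h x hx).1.1, (h x hx).2⟩⟩
  have hmem : ∀ t ∈ Ioo (τ - ε) (τ + ε), ∀ u ∈ Metric.ball (0 : CanonicalSpace) ε,
      t ∈ W ∧ Φ (scaling (c t) u) ∈ gaudinChartDomain R₁ R₂ := by
    intro t ht u hu
    refine hball (t, u) ?_
    rw [← ball_prod_same]
    exact ⟨by rwa [Real.ball_eq_Ioo], hu⟩
  have hIW : ∀ t ∈ Ioo (τ - ε) (τ + ε), t ∈ W := fun t ht =>
    (hmem t ht 0 (Metric.mem_ball_self hε)).1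
  have hsecond : ∀ t ∈ Ioo (τ - ε) (τ + ε), VanishesToOrder 4 (fun u =>
      rationalGaudinH t₁ t₂ t₃ t (gaudinChart R₁ R₂ (Φ (scaling (c t) u)))
        - rationalGaudinH t₁ t₂ t₃ t gaudinM0
        - (gaudinRho R₁ R₂ t₁ t₂ t * hilbertS u + σ * hilbertN u
          - -(σ * (gaudinAlpha R₁ R₂ t₁ t₂ t ^ 2 - β ^ 2)) * hilbertM u)) := by
    intro t ht
    have h := rationalGaudinH_second_order hR₁ hR₂ t₁ t₂ t₃ t
    rw [← hβ] at h
    refine (h.second_order_comp (hc0 t (hIW t ht)) hΦ).congr fun u => ?_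
    have hp : 0 < σ * (gaudinAlpha R₁ R₂ t₁ t₂ t + β) := hIW t ht
    have hk : (gaudinAlpha R₁ R₂ t₁ t₂ t + β) * (c t ^ 2)⁻¹ = σ := by
      rw [hc2 t (hIW t ht), ← div_eq_mul_inv, div_eq_iff hp.ne']
      linear_combination -(gaudinAlpha R₁ R₂ t₁ t₂ t + β) * hσ2
    rw [hk, hc2 t (hIW t ht)]
    ring
  have hcτ : c τ ^ 2 = 2 * (σ * β) := by rw [hc2 τ hτW, hα]; ring
  rw [← hτ]
  -- The scaling multiplies the coefficient `α - β` of `M` by `c² = σ (α + β)`, which gives `ν₂`;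
  -- its derivative at `τ` is `-2 σ β α'`. In the normal form each power of `M` brings a factor
  -- `c²`, and the division by `β` is undone.
  refine ⟨ρ, σ, ε, fun t => gaudinRho R₁ R₂ t₁ t₂ t - ρ,
    fun t => -(σ * (gaudinAlpha R₁ R₂ t₁ t₂ t ^ 2 - β ^ 2)), Metric.ball 0 ε,
    fun t u => gaudinChart R₁ R₂ (Φ (scaling (c t) u)), 0, β * a₄ * c τ ^ 2, β * a₅,
    β * (b ^ 2 / 128) * c τ ^ 6, β * a₇ * c τ ^ 4, β * a₈ * c τ ^ 2, β * a₉, ?_, ?_, rfl, ?_⟩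
  · exact
    { rho_ne_zero := hρ
      sigma_eq := hσ
      eps_pos := hε
      nu₁_smooth := ((contDiff_gaudinRho R₁ R₂ t₁ t₂).sub contDiff_const).contDiffOn
      nu₂_smooth := by fun_prop
      nu₁_zero := sub_self _
      nu₂_zero := by simp [hα]
      transversal := by
        have h := (((((hasDerivAt_gaudinAlpha R₁ R₂ t₁ t₂ τ).pow 2).sub_const (β ^ 2)).const_mul
          σ).neg).deriv
        refine ne_of_eq_of_ne h ?_
        have : 0 < 1 / (2 * R₁) + 1 / (2 * R₂) := by positivity
        simp [hα, hσ0, hβ0]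
        simpa using this.ne'
      coordinates_smooth := hchart.contDiffOn.comp
        (hG.mono fun x hx => ⟨hIW x.1 hx.1, mem_univ _⟩) fun x hx => (hmem x.1 hx.1 x.2 hx.2).2
      coordinates := fun t ht => hchart.comp
        (hΦ.toIsSymplecticMap.comp (isSymplecticMap_scaling (hc0 t (hIW t ht)))) Metric.isOpen_ball
        (Metric.mem_ball_self hε) fun u hu => (hmem t ht u hu).2
      rank_zero := fun t ht => by
        refine fderiv_eq_zero_of_vanishesToOrder (c := R₁ - R₂)
          (d := rationalGaudinH t₁ t₂ t₃ t gaudinM0) ?_ ?_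
        · refine vanishesToOrder_hilbertS.congr fun u => ?_
          rw [gaudinJ_gaudinChart hR₁ hR₂, hΦ.hilbertS_comp, hilbertS_scaling (hc0 t (hIW t ht))]
          ring
        · exact (((((hsecond t ht).mono (by norm_num)).add
            (vanishesToOrder_hilbertS.const_mul (gaudinRho R₁ R₂ t₁ t₂ t))).add
            (vanishesToOrder_hilbertN.const_mul σ)).add (vanishesToOrder_hilbertM.const_mul
              (σ * (gaudinAlpha R₁ R₂ t₁ t₂ t ^ 2 - β ^ 2)))).congr fun u => by ring
      second_order := fun t ht => ((hsecond t ht).mono (l := 3) (by norm_num)).congr fun u => by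
        ring }
  · have h1 := ((hsix.comp hΦ.map_zero (hΦ.differentiable 0)).mono (l := 7) (by norm_num)).add
      (hN.const_mul β)
    refine (h1.comp (Φ := scaling (c τ)) (map_zero _) (scaling (c τ)).differentiableAt).congr
      fun u => ?_
    beta_reduce
    rw [hΦ.hilbertS_comp, hilbertS_scaling (hc0 τ hτW), hilbertN_scaling, hilbertM_scaling]
    have hk : β * 2 * (c τ ^ 2)⁻¹ = σ := by
      rw [hcτ, ← div_eq_mul_inv, div_eq_iff (by positivity)]
      linear_combination -2 * β * hσ2
    linear_combination (-hilbertN u) * hk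
  · have := hc0 τ hτW
    positivity
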